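/- **Setting.** Let $\mathcal X$ be a measurable space that also carries a topology, $\mathcal Y=\{-1,1\}$, $\rho$ a probability measure on $\mathcal X\times\mathcal Y$ with marginal $\rho_{\mathcal X}$ and conditional probability $\rho(1|x)$, and $\mathcal H$ a real reproducing kernel Hilbert space of functions on $\mathcal X$ with kernel $k$, such that $x\mapsto k(x,\cdot)\in\mathcal H$ is strongly measurable. Let $\phi:\mathbb R\to[0,\infty)$, $l(\zeta,y)=\phi(y\zeta)$, $\mathcal L(g)=\mathbb E_{(X,Y)\sim\rho}[l(g(X),Y)]$ and, for $\lambda>0$, $\mathcal L_\lambda(g)=\mathcal L(g)+\frac\lambda2\|g\|_{\mathcal H}^2$. Let $\mathcal R(g)=\mathbb P_{(X,Y)\sim\rho}[\mathrm{sgn}(g(X))\ne Y]$ (with $\mathrm{sgn}(0)=0$) be the classification error. For $\mu\in(0,1)$ put $h_*(\mu)=\arg\min_{h\in\mathbb R}\{\mu\phi(h)+(1-\mu)\phi(-h)\}$, $l_*(\mu)=\min_{h\in\mathbb R}\{\mu\phi(h)+(1-\mu)\phi(-h)\}$ and $d_{l_*}(\eta_1,\eta_2)=-l_*(\eta_2)+l_*(\eta_1)+l_*'(\eta_1)(\eta_2-\eta_1)$.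 A Bayes rule for $\mathcal L$ is a measurable function $\mathcal X\to\mathbb R$ minimizing $\mathcal L$ over all measurable functions. **Assumptions.** (A1) $\phi$ is differentiable and convex, and $|\partial_\zeta l(\zeta,y)|\le M$ for all $\zeta,y$, where $M>0$. (A2) $\mathrm{supp}(\rho_{\mathcal X})=\mathcal X$, and $k(x,x)\le R^2$ for all $x\in\mathcal X$, where $R>0$. (A3) $\delta\in(0,1/2)$ and $|\rho(1|x)-\frac12|>\delta$ for $\rho_{\mathcal X}$-almost every $x$. (A4) $\rho(1|x)\in(0,1)$ for $\rho_{\mathcal X}$-almost every $x$; $h_*$ is well defined (the minimizer exists and is unique), differentiable, monotonically increasing and injective on $(0,1)$; and $\mathrm{sgn}(\mu-\frac12)=\mathrm{sgn}(h_*(\mu))$ for all $\mu\in(0,1)$. (A5) For $\eta_1,\eta_2\in(0,1)$, $d_{l_*}(\eta_1,\eta_2)=0$ if and only if $\eta_1=\eta_2$; and there is $g_*\in\mathcal H$ that is a Bayes rule for $\mathcal L$ and to which every Bayes rule for $\mathcal L$ is equal $\rho_{\mathcal X}$-almost everywhere. Put $m(\delta)=\max\{h_*(\tfrac12+\delta),|h_*(\tfrac12-\delta)|\}$.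 **Theorem.** Under (A1)–(A5) there is $\lambda_0>0$ such that for every $\lambda\in(0,\lambda_0]$ the following holds. The functional $\mathcal L_\lambda$ has a unique minimizer $g_\lambda$ over $\mathcal H$. Let $\gamma>0$, $\eta_t=\frac{2}{\lambda(\gamma+t)}$ with $\eta_1\le\frac1{2\lambda}$, let $g_1\in\mathcal H$ with $\|g_1\|_{\mathcal H}\le(2\eta_1+\frac1\lambda)MR$, and let $T\ge0$ be an integer such that $$\max\left\{\frac{36M^2R^2}{\lambda^2(2\gamma+T)},\ \frac{\gamma(\gamma-1)\|g_1-g_\lambda\|_{\mathcal H}^2}{(2\gamma+T)(T+1)}\right\}\le\frac{m(\delta)^2}{32R^2}.$$ Let $(X_t,Y_t)$, $t\ge1$, be i.i.d. with law $\rho$, let $g_{t+1}=g_t-\eta_t\big(\partial_\zeta l(g_t(X_t),Y_t)\,k(X_t,\cdot)+\lambda g_t\big)$, and let $$\overline g_{T+1}=\sum_{t=1}^{T+1}\alpha_t g_t,\qquad \alpha_t=\frac{2(\gamma+t-1)}{(2\gamma+T)(T+1)}.$$ Then $\mathcal R(\overline g_{T+1})-\mathcal R(\mathbb E[Y|x])$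 is integrable, where $\mathbb E[Y|x]=2\rho(1|x)-1$ is viewed as a function of $x$, and $$\mathbb E\big[\mathcal R(\overline g_{T+1})-\mathcal R(\mathbb E[Y|x])\big]\le 2\exp\left(-\frac{m(\delta)^2\lambda^2(2\gamma+T)}{2^{10}\cdot 9\,M^2R^4}\right).$$ -/

import Mathlib

open MeasureTheory ProbabilityTheory

noncomputable section

/-- The set of binary labels `{-1, 1}`. -/
abbrev Label : Type := ({-1, 1} : Set ℝ)

/-- The label `1`. -/
def Label.one : Label := ⟨1, by simp⟩

instance : Nonempty Label := ⟨Label.one⟩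

/-! ### Loss, link function, Bregman divergence -/

/-- The loss `l(ζ, y) = φ(y ζ)`. -/
def loss (φ : ℝ → ℝ) (ζ : ℝ) (y : Label) : ℝ := φ ((y : ℝ) * ζ)

/-- The partial derivative `∂_ζ l(ζ, y)`. -/
def dloss (φ : ℝ → ℝ) (ζ : ℝ) (y : Label) : ℝ := deriv (fun ζ' => loss φ ζ' y) ζ

/-- `μ φ(h) + (1 - μ) φ(-h)`. -/
def condRisk (φ : ℝ → ℝ) (μ h : ℝ) : ℝ := μ * φ h + (1 - μ) * φ (-h)

/-- The link function is well defined: for every `μ ∈ (0,1)` there is exactly one minimizer of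
`h ↦ μ φ(h) + (1 - μ) φ(-h)`. -/
def LinkWellDefined (φ : ℝ → ℝ) : Prop :=
  ∀ μ ∈ Set.Ioo (0 : ℝ) 1, ∃! h : ℝ, ∀ h' : ℝ, condRisk φ μ h ≤ condRisk φ μ h'

/-- The link function `h_*(μ) = argmin_h (μ φ(h) + (1 - μ) φ(-h))`
(meaningful for `μ ∈ (0,1)` when `LinkWellDefined φ`). -/
def linkFun (φ : ℝ → ℝ) (μ : ℝ) : ℝ :=
  Classical.epsilon fun h : ℝ => ∀ h' : ℝ, condRisk φ μ h ≤ condRisk φ μ h'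

/-- The value `l_*(μ) = min_h (μ φ(h) + (1 - μ) φ(-h))`. -/
def lstar (φ : ℝ → ℝ) (μ : ℝ) : ℝ := ⨅ h : ℝ, condRisk φ μ h

/-- The Bregman divergence
`d_{l_*}(η₁, η₂) = -l_*(η₂) + l_*(η₁) + l_*'(η₁) (η₂ - η₁)`. -/
def bregman (φ : ℝ → ℝ) (η₁ η₂ : ℝ) : ℝ :=
  -lstar φ η₂ + lstar φ η₁ + deriv (lstar φ) η₁ * (η₂ - η₁)

/-- `m(δ) = max {h_*(1/2 + δ), |h_*(1/2 - δ)|}`. -/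
def margin (φ : ℝ → ℝ) (δ : ℝ) : ℝ :=
  max (linkFun φ (1 / 2 + δ)) |linkFun φ (1 / 2 - δ)|

/-! ### Risks -/

section Risk

variable {X : Type*} [MeasurableSpace X]

/-- The conditional label probability `ρ(1 | x)`. -/
def condProb (ρ : Measure (X × Label)) [IsFiniteMeasure ρ] (x : X) : ℝ :=
  (ρ.condKernel x).real {Label.one}

/-- The conditional mean `E[Y | x]`. -/
def condMean (ρ : Measure (X × Label)) [IsFiniteMeasure ρ] (x : X) : ℝ :=
  ∫ y, (y : ℝ) ∂(ρ.condKernel x)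

/-- The `0`-`1` error function `I`. -/
def zeroOne (y y' : ℝ) : ℝ := if y ≠ y' then 1 else 0

/-- The expected classification error `R(g) = E[I(sgn(g(X)), Y)]`. -/
def classError (ρ : Measure (X × Label)) (g : X → ℝ) : ℝ :=
  ∫ z, zeroOne (Real.sign (g z.1)) (z.2 : ℝ) ∂ρ

/-- The expected risk `E[l(g(X), Y)] ∈ [0, ∞]` of an arbitrary measurable function
(for a non-negative loss). -/
def extRisk (ρ : Measure (X × Label)) (φ : ℝ → ℝ) (g : X → ℝ) : ENNReal :=
  ∫⁻ z, ENNReal.ofReal (loss φ (g z.1) z.2) ∂ρ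

/-- `g` is a Bayes rule for the expected risk: it minimizes it over all measurable functions. -/
def IsBayesRule (ρ : Measure (X × Label)) (φ : ℝ → ℝ) (g : X → ℝ) : Prop :=
  Measurable g ∧ ∀ f : X → ℝ, Measurable f → extRisk ρ φ g ≤ extRisk ρ φ f

end Risk

/-! ### The reproducing kernel Hilbert space and stochastic gradient descent -/

section SGD

variable {X H : Type*} [NormedAddCommGroup H] [InnerProductSpace ℝ H] [CompleteSpace H]
  [RKHS ℝ H X ℝ]

/-- The real-valued reproducing kernel `k(x, x')` of `H`. -/
def kern (H : Type*) {X : Type*} [NormedAddCommGroup H] [InnerProductSpace ℝ H]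
    [CompleteSpace H] [RKHS ℝ H X ℝ] (x x' : X) : ℝ := RKHS.kernel H x x' 1

/-- The function `k(x, ·)` as an element of `H`. -/
def feature (H : Type*) {X : Type*} [NormedAddCommGroup H] [InnerProductSpace ℝ H]
    [CompleteSpace H] [RKHS ℝ H X ℝ] (x : X) : H := RKHS.kerFun H x 1

/-- The regularized expected risk `L_λ(g) = E[l(g(X), Y)] + λ/2 ‖g‖²` on `H`. -/
def regRisk [MeasurableSpace X] (ρ : Measure (X × Label)) (φ : ℝ → ℝ) (lam : ℝ) (g : H) : ℝ :=
  (∫ z, loss φ (g z.1) z.2 ∂ρ) + lam / 2 * ‖g‖ ^ 2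

/-- The stochastic gradient `G_λ(g, (x, y)) = ∂_ζ l(g(x), y) k(x, ·) + λ g`. -/
def stochGrad (φ : ℝ → ℝ) (lam : ℝ) (g : H) (z : X × Label) : H :=
  dloss φ (g z.1) z.2 • feature H z.1 + lam • g

/-- Stochastic gradient descent with learning rates `η₁, η₂, …` along the samples `z₁, z₂, …`:
the value at `n` is the iterate `g_{n+1}`, where `g_{t+1} = g_t - η_t G_λ(g_t, z_t)`. -/
def sgd (φ : ℝ → ℝ) (lam : ℝ) (η : ℕ → ℝ) (g₁ : H) (z : ℕ → X × Label) : ℕ → H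
  | 0 => g₁
  | n + 1 => sgd φ lam η g₁ z n - η (n + 1) • stochGrad φ lam (sgd φ lam η g₁ z n) (z (n + 1))

/-- The weighted average `∑_{t=1}^{T+1} α_t g_t` of the iterates. -/
def avgSgd (φ : ℝ → ℝ) (lam : ℝ) (η α : ℕ → ℝ) (g₁ : H) (T : ℕ) (z : ℕ → X × Label) : H :=
  ∑ n ∈ Finset.range (T + 1), α (n + 1) • sgd φ lam η g₁ z n

/-- The learning rate `η_t = 2 / (λ (γ + t))`. -/
def stepSize (lam γ : ℝ) (t : ℕ) : ℝ := 2 / (lam * (γ + t))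

/-- The averaging weight `α_t = 2 (γ + t - 1) / ((2γ + T)(T + 1))`. -/
def avgWeight (γ : ℝ) (T t : ℕ) : ℝ := 2 * (γ + t - 1) / ((2 * γ + T) * (T + 1))

end SGD

end

/-!
The regularized minimizers `g_λ` converge in norm, as `λ → 0`, to a minimizer `q ∈ H` of the risk:
their norms increase as `λ` decreases and are bounded by the norm of any risk minimizer, so strong
convexity makes them Cauchy. Since a Bayes rule lies in `H`, `q` is one, hence
`q = h_*(ρ(1 | ·))` almost everywhere, so that `|q| ≥ m(δ)` with the sign of `E[Y | ·]`. By the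
reproducing property `|g - q| ≤ R ‖g - q‖`, so every `g` with `‖g - q‖ < m(δ) / R` classifies
optimally. For small `λ` it remains to bound the probability that the averaged iterate is farther
than `m(δ) / (2R)` from `g_λ`.

With `w_n = λ² (γ + n - 1)(γ + n) / 4`, strong convexity gives
`w_{n+1} E‖g_{n+2} - g_λ‖² ≤ w_n ‖g_{n+1} - g_λ‖² - (λ²/2)(γ + n) ‖g_{n+1} - g_λ‖² + O(1)`,
where the expectation is over the sample drawn at that step. By Hoeffding's lemma the exponential
moment of the noise costs a term quadratic in the multiplier and proportional to
`w_n ‖g_{n+1} - g_λ‖²`. Letting the multiplier decrease slowly in `n` absorbs this cost, so the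
energy is an exponential supermartingale up to a factor bounded by `e³`, and it retains a fixed
multiple of the accumulated drift, which by Jensen's inequality dominates the squared distance of
the weighted average from `g_λ`. Markov's inequality concludes.
-/

noncomputable section

section StrongConvexity

open Filter Topology

theorem le_of_tendsto_of_lowerSemicontinuousAt {ι E : Type*} [TopologicalSpace E] {l : Filter ι}
    [l.NeBot] {f : E → ℝ} {u : ι → E} {v : ι → ℝ} {p : E} {a : ℝ}
    (hf : LowerSemicontinuousAt f p) (hu : Tendsto u l (𝓝 p)) (hv : Tendsto v l (𝓝 a))
    (huv : ∀ᶠ i in l, f (u i) ≤ v i) : f p ≤ a := by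
  by_contra! hlt
  obtain ⟨c, hac, hcf⟩ := exists_between hlt
  obtain ⟨i, hci, hic, hle⟩ :=
    ((hu.eventually (hf c hcf)).and ((hv.eventually_lt_const hac).and huv)).exists
  exact (hci.trans_le (hle.trans hic.le)).false

section Minimizers

variable {E : Type*} [NormedAddCommGroup E] [NormedSpace ℝ E] {f : E → ℝ} {m : ℝ}

theorem strongConvexOn_quadratic_growth {s : Set E} (hf : StrongConvexOn s m f) {p g : E}
    (hps : p ∈ s) (hgs : g ∈ s) (hp : IsMinOn f s p) : f p + m / 2 * ‖g - p‖ ^ 2 ≤ f g := by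
  have hseg : ∀ t ∈ Set.Ioo (0 : ℝ) 1, f p + m / 2 * ‖g - p‖ ^ 2 * (1 - t) ≤ f g := by
    intro t ht
    have ht' : 0 ≤ 1 - t := by linarith [ht.2]
    have hmin : f p ≤ f (t • g + (1 - t) • p) :=
      hp (hf.1 hgs hps ht.1.le ht' (add_sub_cancel t 1))
    have hconv := hf.2 hgs hps ht.1.le ht' (add_sub_cancel t 1)
    simp only [smul_eq_mul] at hconv
    refine le_of_mul_le_mul_left ?_ ht.1
    linarith
  have hlim : Tendsto (fun t : ℝ => f p + m / 2 * ‖g - p‖ ^ 2 * (1 - t)) (𝓝[>] 0)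
      (𝓝 (f p + m / 2 * ‖g - p‖ ^ 2)) :=
    tendsto_nhdsWithin_of_tendsto_nhds (Continuous.tendsto' (by fun_prop) _ _ (by ring))
  exact le_of_tendsto hlim (by filter_upwards [Ioo_mem_nhdsGT (zero_lt_one' ℝ)] using hseg)

theorem strongConvexOn_norm_sub_sq_le (hf : StrongConvexOn Set.univ m f) {a : ℝ}
    (ha : ∀ x, a ≤ f x) (x y : E) :
    m / 8 * ‖x - y‖ ^ 2 ≤ (f x - a) / 2 + (f y - a) / 2 := by
  have hconv := hf.2 (Set.mem_univ x) (Set.mem_univ y) (one_half_pos (α := ℝ)).le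
    (one_half_pos (α := ℝ)).le (add_halves 1)
  have hmid := ha ((1 / 2 : ℝ) • x + (1 / 2 : ℝ) • y)
  simp only [smul_eq_mul] at hconv
  linarith

theorem exists_isMinOn_of_strongConvexOn [CompleteSpace E] (hm : 0 < m)
    (hf : StrongConvexOn Set.univ m f) (hlsc : LowerSemicontinuous f)
    (hbdd : BddBelow (Set.range f)) : ∃ p, IsMinOn f Set.univ p := by
  have hex : ∀ n : ℕ, ∃ u, f u < (⨅ g, f g) + 1 / ((n : ℝ) + 1) := fun n =>
    exists_lt_of_ciInf_lt (lt_add_of_pos_right _ (by positivity))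
  choose u hu using hex
  have hcauchy : CauchySeq u := by
    refine cauchySeq_of_le_tendsto_0' (fun n : ℕ => √(8 / m * (1 / ((n : ℝ) + 1)))) ?_ ?_
    · intro n k hnk
      have hsq := strongConvexOn_norm_sub_sq_le hf (ciInf_le hbdd) (u n) (u k)
      have hkn : 1 / ((k : ℝ) + 1) ≤ 1 / ((n : ℝ) + 1) := Nat.one_div_le_one_div hnk
      refine Real.le_sqrt_of_sq_le ?_
      rw [dist_eq_norm, div_mul_eq_mul_div, le_div_iff₀ hm]
      linarith [hu n, hu k]
    · simpa using ((tendsto_one_div_add_atTop_nhds_zero_nat (𝕜 := ℝ)).const_mul (8 / m)).sqrt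
  obtain ⟨p, hp⟩ := cauchySeq_tendsto_of_complete hcauchy
  have hinf : f p ≤ ⨅ g, f g :=
    le_of_tendsto_of_lowerSemicontinuousAt (hlsc p) hp
      (by simpa using tendsto_one_div_add_atTop_nhds_zero_nat.const_add (⨅ g, f g))
      (Eventually.of_forall fun n => (hu n).le)
  exact ⟨p, isMinOn_univ_iff.2 fun g => hinf.trans (ciInf_le hbdd g)⟩

end Minimizers

section Tikhonov

variable {E : Type*} [NormedAddCommGroup E] {L : E → ℝ} {lam : ℝ}

/-- The Tikhonov regularization `L + lam / 2 ‖·‖²` of a functional `L`. -/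
def tikhonov (L : E → ℝ) (lam : ℝ) (g : E) : ℝ := L g + lam / 2 * ‖g‖ ^ 2

theorem norm_sq_le_of_isMinOn_tikhonov (hlam : 0 < lam) {g₀ p : E} (hg₀ : IsMinOn L Set.univ g₀)
    (hp : IsMinOn (tikhonov L lam) Set.univ p) : ‖p‖ ^ 2 ≤ ‖g₀‖ ^ 2 := by
  have hpg := isMinOn_univ_iff.1 hp g₀
  have hgp := isMinOn_univ_iff.1 hg₀ p
  simp only [tikhonov] at hpg
  refine le_of_mul_le_mul_left ?_ (half_pos hlam)
  linarith

variable [InnerProductSpace ℝ E]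

theorem strongConvexOn_tikhonov {s : Set E} (hL : ConvexOn ℝ s L) (lam : ℝ) :
    StrongConvexOn s lam (tikhonov L lam) :=
  strongConvexOn_iff_convex.2 (by simpa only [tikhonov, add_sub_cancel_right] using hL)

theorem exists_isMinOn_tikhonov [CompleteSpace E] (hL : ConvexOn ℝ Set.univ L)
    (hlsc : LowerSemicontinuous L) (hbdd : BddBelow (Set.range L)) (hlam : 0 < lam) :
    ∃ p, IsMinOn (tikhonov L lam) Set.univ p := by
  obtain ⟨b, hb⟩ := hbdd
  refine exists_isMinOn_of_strongConvexOn hlam (strongConvexOn_tikhonov hL lam)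
    (hlsc.add (Continuous.lowerSemicontinuous (by fun_prop))) ⟨b, ?_⟩
  rintro _ ⟨g, rfl⟩
  exact (hb ⟨g, rfl⟩).trans (le_add_of_nonneg_right (by positivity))

theorem norm_sub_sq_le_of_isMinOn_tikhonov (hL : ConvexOn ℝ Set.univ L) {a b : ℝ} (ha : 0 < a)
    (hab : a ≤ b) {p q : E} (hp : IsMinOn (tikhonov L a) Set.univ p)
    (hq : IsMinOn (tikhonov L b) Set.univ q) : ‖p - q‖ ^ 2 ≤ ‖p‖ ^ 2 - ‖q‖ ^ 2 := by
  have hpq := strongConvexOn_quadratic_growth (strongConvexOn_tikhonov hL a) (Set.mem_univ p)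
    (Set.mem_univ q) hp
  have hqp := strongConvexOn_quadratic_growth (strongConvexOn_tikhonov hL b) (Set.mem_univ q)
    (Set.mem_univ p) hq
  rw [norm_sub_rev q p] at hpq
  simp only [tikhonov] at hpq hqp
  rcases hab.eq_or_lt with rfl | hlt
  · have hzero : ‖p - q‖ ^ 2 = 0 := by nlinarith [sq_nonneg ‖p - q‖]
    have heq : p = q := by simpa [sub_eq_zero] using hzero
    simp [heq]
  · refine le_of_mul_le_mul_left ?_ (sub_pos.2 hlt)
    have : 0 ≤ a * ‖p - q‖ ^ 2 := by positivity
    linarith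

theorem cauchy_of_isMinOn_tikhonov (hL : ConvexOn ℝ Set.univ L) {g₀ : E}
    (hg₀ : IsMinOn L Set.univ g₀) {p : ℝ → E}
    (hp : ∀ lam, 0 < lam → IsMinOn (tikhonov L lam) Set.univ (p lam)) :
    Cauchy (map p (𝓝[>] 0)) := by
  have hsq {a b : ℝ} (ha : 0 < a) (hab : a ≤ b) : ‖p a - p b‖ ^ 2 ≤ ‖p a‖ ^ 2 - ‖p b‖ ^ 2 :=
    norm_sub_sq_le_of_isMinOn_tikhonov hL ha hab (hp a ha) (hp b (ha.trans_le hab))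
  obtain ⟨ℓ, hℓ⟩ : ∃ ℓ, Tendsto (fun a => ‖p a‖ ^ 2) (𝓝[>] 0) (𝓝 ℓ) :=
    ⟨_, AntitoneOn.tendsto_nhdsGT
      (fun a ha b _ hab => sub_nonneg.1 ((sq_nonneg _).trans (hsq ha hab)))
      ⟨‖g₀‖ ^ 2, by rintro _ ⟨a, ha, rfl⟩; exact norm_sq_le_of_isMinOn_tikhonov ha hg₀ (hp a ha)⟩⟩
  refine Metric.cauchy_iff.2 ⟨inferInstance, fun ε hε => ?_⟩
  obtain ⟨t, ht, hsmall⟩ := (Metric.cauchy_iff.1 hℓ.cauchy_map).2 (ε ^ 2) (by positivity)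
  refine ⟨p '' ((fun a => ‖p a‖ ^ 2) ⁻¹' t ∩ Set.Ioi 0),
    image_mem_map (inter_mem ht self_mem_nhdsWithin), ?_⟩
  have hdist {a b : ℝ} (ha : 0 < a) (hat : ‖p a‖ ^ 2 ∈ t) (hbt : ‖p b‖ ^ 2 ∈ t) (hab : a ≤ b) :
      dist (p a) (p b) < ε := by
    rw [dist_eq_norm]
    exact lt_of_pow_lt_pow_left₀ 2 hε.le
      ((hsq ha hab).trans_lt ((le_abs_self _).trans_lt (hsmall _ hat _ hbt)))
  rintro _ ⟨a, ⟨hat, ha⟩, rfl⟩ _ ⟨b, ⟨hbt, hb⟩, rfl⟩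
  rcases le_total a b with hab | hba
  · exact hdist ha hat hbt hab
  · exact dist_comm (p a) (p b) ▸ hdist hb hbt hat hba

theorem exists_tendsto_isMinOn_tikhonov [CompleteSpace E] (hL : ConvexOn ℝ Set.univ L)
    (hlsc : LowerSemicontinuous L) {g₀ : E} (hg₀ : IsMinOn L Set.univ g₀) {p : ℝ → E}
    (hp : ∀ lam, 0 < lam → IsMinOn (tikhonov L lam) Set.univ (p lam)) :
    ∃ q, Tendsto p (𝓝[>] 0) (𝓝 q) ∧ IsMinOn L Set.univ q := by
  obtain ⟨q, hq⟩ := CompleteSpace.complete (cauchy_of_isMinOn_tikhonov hL hg₀ hp)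
  have hlim : Tendsto (fun lam => tikhonov L lam g₀) (𝓝[>] 0) (𝓝 (L g₀)) :=
    tendsto_nhdsWithin_of_tendsto_nhds
      (Continuous.tendsto' (by unfold tikhonov; fun_prop) _ _ (by simp [tikhonov]))
  have hle : ∀ᶠ lam in 𝓝[>] 0, L (p lam) ≤ tikhonov L lam g₀ := by
    filter_upwards [self_mem_nhdsWithin] with lam (hlam : 0 < lam)
    exact (le_add_of_nonneg_right (by positivity)).trans (isMinOn_univ_iff.1 (hp lam hlam) g₀)
  have hqg₀ : L q ≤ L g₀ := le_of_tendsto_of_lowerSemicontinuousAt (hlsc q) hq hlim hle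
  exact ⟨q, hq, isMinOn_univ_iff.2 fun g => hqg₀.trans (isMinOn_univ_iff.1 hg₀ g)⟩

end Tikhonov

end StrongConvexity

section Loss

open scoped NNReal

/-- The label `-1`. -/
def Label.negOne : Label := ⟨-1, by simp⟩

theorem Label.eq_one_or_eq_negOne (y : Label) : y = Label.one ∨ y = Label.negOne :=
  y.2.symm.imp Subtype.ext Subtype.ext

theorem Label.abs_coe (y : Label) : |(y : ℝ)| = 1 := by
  rcases y.eq_one_or_eq_negOne with rfl | rfl <;> simp [Label.one, Label.negOne]

variable {φ : ℝ → ℝ}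

theorem dloss_eq (hφ : Differentiable ℝ φ) (ζ : ℝ) (y : Label) :
    dloss φ ζ y = y * deriv φ (y * ζ) := by
  have h : HasDerivAt (fun ζ' : ℝ => φ (y * ζ')) (deriv φ (y * ζ) * (y * 1)) ζ :=
    (hφ _).hasDerivAt.comp ζ ((hasDerivAt_id ζ).const_mul (y : ℝ))
  simp only [dloss, loss, h.deriv]
  ring

theorem lipschitzWith_of_abs_dloss_le (hφ : Differentiable ℝ φ) {M : ℝ}
    (hM : ∀ (ζ : ℝ) (y : Label), |dloss φ ζ y| ≤ M) : LipschitzWith M.toNNReal φ := by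
  refine lipschitzWith_of_nnnorm_deriv_le hφ fun ζ => NNReal.le_toNNReal_of_coe_le ?_
  simpa [dloss_eq hφ, Label.one] using hM ζ Label.one

theorem convexOn_add_deriv_mul_sub_le (hφ : Differentiable ℝ φ) (hc : ConvexOn ℝ Set.univ φ)
    (a b : ℝ) : φ a + deriv φ a * (b - a) ≤ φ b := by
  rcases lt_trichotomy a b with h | rfl | h
  · have := hc.le_slope_of_hasDerivAt (Set.mem_univ a) (Set.mem_univ b) h (hφ a).hasDerivAt
    rw [slope_def_field, le_div_iff₀ (sub_pos.2 h)] at this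
    linarith
  · simp
  · have := hc.slope_le_of_hasDerivAt (Set.mem_univ b) (Set.mem_univ a) h (hφ a).hasDerivAt
    rw [slope_def_field, div_le_iff₀ (sub_pos.2 h)] at this
    linarith

theorem loss_add_dloss_mul_sub_le (hφ : Differentiable ℝ φ) (hc : ConvexOn ℝ Set.univ φ)
    (a b : ℝ) (y : Label) : loss φ a y + dloss φ a y * (b - a) ≤ loss φ b y := by
  have := convexOn_add_deriv_mul_sub_le hφ hc (y * a) (y * b)
  simp only [dloss_eq hφ, loss]
  linarith

theorem convexOn_loss (hc : ConvexOn ℝ Set.univ φ) (y : Label) :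
    ConvexOn ℝ Set.univ fun ζ => loss φ ζ y :=
  hc.comp_linearMap (LinearMap.mulLeft ℝ (y : ℝ))

theorem abs_loss_sub_le {K : ℝ≥0} (hφ : LipschitzWith K φ) (u v : ℝ) (y : Label) :
    |loss φ u y - loss φ v y| ≤ K * |u - v| := by
  simpa [loss, Real.dist_eq, ← mul_sub, abs_mul, Label.abs_coe] using hφ.dist_le_mul (y * u) (y * v)

theorem measurable_loss (hφ : Measurable φ) {α : Type*} [MeasurableSpace α] {f : α → ℝ}
    {y : α → Label} (hf : Measurable f) (hy : Measurable y) :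
    Measurable fun z => loss φ (f z) (y z) :=
  hφ.comp ((measurable_subtype_coe.comp hy).mul hf)

theorem measurable_dloss (hφ : Differentiable ℝ φ) {α : Type*} [MeasurableSpace α] {f : α → ℝ}
    {y : α → Label} (hf : Measurable f) (hy : Measurable y) :
    Measurable fun z => dloss φ (f z) (y z) := by
  simp only [dloss_eq hφ]
  exact (measurable_subtype_coe.comp hy).mul
    ((measurable_deriv φ).comp ((measurable_subtype_coe.comp hy).mul hf))

end Loss

section Risk

open scoped NNReal

variable {X H : Type*} [NormedAddCommGroup H] [InnerProductSpace ℝ H] [RKHS ℝ H X ℝ]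

section Definition

variable [MeasurableSpace X]

/-- The expected risk `L(g) = E[l(g(X), Y)]` of an element of `H`. -/
def risk (ρ : Measure (X × Label)) (φ : ℝ → ℝ) (g : H) : ℝ := ∫ z, loss φ (g z.1) z.2 ∂ρ

theorem regRisk_eq_tikhonov (ρ : Measure (X × Label)) (φ : ℝ → ℝ) (lam : ℝ) :
    regRisk (H := H) ρ φ lam = tikhonov (risk ρ φ) lam :=
  rfl

theorem risk_nonneg {ρ : Measure (X × Label)} {φ : ℝ → ℝ} (hφ : ∀ v, 0 ≤ φ v) (g : H) :
    0 ≤ risk ρ φ g :=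
  integral_nonneg fun _ => hφ _

end Definition

variable [CompleteSpace H]

theorem inner_feature (x : X) (g : H) : inner ℝ (feature H x) g = g x := by
  simp [feature]

theorem kern_self (x : X) : kern H x x = ‖feature H x‖ ^ 2 := by
  have h := RKHS.kernel_inner (𝕜 := ℝ) H x x (1 : ℝ) (1 : ℝ)
  rw [real_inner_self_eq_norm_sq] at h
  simp [feature, kern, ← h]

theorem norm_feature_le {R : ℝ} (hR : 0 ≤ R) (hkR : ∀ x : X, kern H x x ≤ R ^ 2) (x : X) :
    ‖feature H x‖ ≤ R :=
  le_of_sq_le_sq (kern_self (H := H) x ▸ hkR x) hR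

theorem abs_apply_le {R : ℝ} (hF : ∀ x : X, ‖feature H x‖ ≤ R) (g : H) (x : X) :
    |g x| ≤ R * ‖g‖ := by
  rw [← inner_feature]
  exact (abs_real_inner_le_norm _ _).trans (by gcongr; exact hF x)

theorem abs_apply_sub_le {R : ℝ} (hF : ∀ x : X, ‖feature H x‖ ≤ R) (g h : H) (x : X) :
    |g x - h x| ≤ R * ‖g - h‖ := by
  rw [← Pi.sub_apply, ← RKHS.coe_sub]
  exact abs_apply_le hF _ _

variable [MeasurableSpace X]

theorem measurable_apply (hk : StronglyMeasurable (fun x : X => feature H x)) (g : H) :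
    Measurable fun x : X => g x := by
  simp only [← inner_feature]
  exact (hk.inner stronglyMeasurable_const).measurable

variable {ρ : Measure (X × Label)} [IsProbabilityMeasure ρ] {φ : ℝ → ℝ} {K : ℝ≥0} {R : ℝ}

theorem integrable_loss (hk : StronglyMeasurable (fun x : X => feature H x))
    (hφ : LipschitzWith K φ) (hF : ∀ x : X, ‖feature H x‖ ≤ R) (g : H) :
    Integrable (fun z : X × Label => loss φ (g z.1) z.2) ρ := by
  refine Integrable.of_bound (C := |φ 0| + K * (R * ‖g‖)) (measurable_loss hφ.continuous.measurable
    ((measurable_apply hk g).comp measurable_fst) measurable_snd).aestronglyMeasurable ?_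
  refine Filter.Eventually.of_forall fun z => ?_
  calc |loss φ (g z.1) z.2| = |loss φ 0 z.2 + (loss φ (g z.1) z.2 - loss φ 0 z.2)| := by
        rw [add_sub_cancel]
    _ ≤ |loss φ 0 z.2| + |loss φ (g z.1) z.2 - loss φ 0 z.2| := abs_add_le _ _
    _ ≤ |φ 0| + K * |g z.1 - 0| :=
        add_le_add (by simp [loss]) (abs_loss_sub_le hφ _ _ _)
    _ ≤ |φ 0| + K * (R * ‖g‖) := by
        rw [sub_zero]
        gcongr
        exact abs_apply_le hF g z.1

theorem convexOn_risk (hk : StronglyMeasurable (fun x : X => feature H x))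
    (hφ : LipschitzWith K φ) (hc : ConvexOn ℝ Set.univ φ) (hF : ∀ x : X, ‖feature H x‖ ≤ R) :
    ConvexOn ℝ Set.univ (risk (H := H) ρ φ) := by
  refine ⟨convex_univ, fun g _ h _ a b ha hb hab => ?_⟩
  have hi := integrable_loss (ρ := ρ) hk hφ hF
  simp only [risk, smul_eq_mul]
  rw [← integral_const_mul, ← integral_const_mul,
    ← integral_add ((hi g).const_mul a) ((hi h).const_mul b)]
  refine integral_mono (hi _) (((hi g).const_mul a).add ((hi h).const_mul b)) fun z => ?_
  simpa using (convexOn_loss hc z.2).2 (Set.mem_univ (g z.1)) (Set.mem_univ (h z.1)) ha hb hab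

theorem continuous_risk (hk : StronglyMeasurable (fun x : X => feature H x))
    (hφ : LipschitzWith K φ) (hF : ∀ x : X, ‖feature H x‖ ≤ R) :
    Continuous (risk (H := H) ρ φ) := by
  have hi := integrable_loss (ρ := ρ) hk hφ hF
  refine (LipschitzWith.of_dist_le' (K := K * R) fun g h => ?_).continuous
  rw [dist_eq_norm, dist_eq_norm, risk, risk, ← integral_sub (hi g) (hi h)]
  have hbound : ∀ z : X × Label,
      ‖loss φ (g z.1) z.2 - loss φ (h z.1) z.2‖ ≤ K * R * ‖g - h‖ := fun z =>
    (abs_loss_sub_le hφ _ _ _).trans (by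
      rw [mul_assoc]
      gcongr
      exact abs_apply_sub_le hF g h z.1)
  simpa using norm_integral_le_of_norm_le_const (μ := ρ) (Filter.Eventually.of_forall hbound)

theorem extRisk_eq_ofReal_risk (hφ0 : ∀ v, 0 ≤ φ v)
    (hk : StronglyMeasurable (fun x : X => feature H x)) (hφ : LipschitzWith K φ)
    (hF : ∀ x : X, ‖feature H x‖ ≤ R) (g : H) :
    extRisk ρ φ (fun x => g x) = ENNReal.ofReal (risk ρ φ g) :=
  (ofReal_integral_eq_lintegral_ofReal (integrable_loss hk hφ hF g)
    (Filter.Eventually.of_forall fun _ => hφ0 _)).symm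

end Risk

section Link

variable {φ : ℝ → ℝ} {μ : ℝ}

theorem condRisk_linkFun_le (hlink : LinkWellDefined φ) (hμ : μ ∈ Set.Ioo (0 : ℝ) 1) (h : ℝ) :
    condRisk φ μ (linkFun φ μ) ≤ condRisk φ μ h :=
  Classical.epsilon_spec (hlink μ hμ).exists h

theorem eq_linkFun_of_condRisk_le (hlink : LinkWellDefined φ) (hμ : μ ∈ Set.Ioo (0 : ℝ) 1) {h : ℝ}
    (hh : condRisk φ μ h ≤ condRisk φ μ (linkFun φ μ)) : h = linkFun φ μ :=
  (hlink μ hμ).unique (fun h' => hh.trans (condRisk_linkFun_le hlink hμ h'))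
    (condRisk_linkFun_le hlink hμ)

theorem condRisk_one_sub (φ : ℝ → ℝ) (μ h : ℝ) : condRisk φ (1 - μ) h = condRisk φ μ (-h) := by
  simp only [condRisk, neg_neg]
  ring

theorem condRisk_nonneg (hφ0 : ∀ v, 0 ≤ φ v) (hμ : μ ∈ Set.Ioo (0 : ℝ) 1) (h : ℝ) :
    0 ≤ condRisk φ μ h :=
  add_nonneg (mul_nonneg hμ.1.le (hφ0 _)) (mul_nonneg (sub_nonneg.2 hμ.2.le) (hφ0 _))

theorem one_sub_mem_Ioo (hμ : μ ∈ Set.Ioo (0 : ℝ) 1) : 1 - μ ∈ Set.Ioo (0 : ℝ) 1 :=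
  ⟨sub_pos.2 hμ.2, sub_lt_self 1 hμ.1⟩

theorem linkFun_one_sub (hlink : LinkWellDefined φ) (hμ : μ ∈ Set.Ioo (0 : ℝ) 1) :
    linkFun φ (1 - μ) = -linkFun φ μ := by
  refine (eq_linkFun_of_condRisk_le hlink (one_sub_mem_Ioo hμ) ?_).symm
  rw [condRisk_one_sub, condRisk_one_sub, neg_neg]
  exact condRisk_linkFun_le hlink hμ _

theorem margin_eq_abs_linkFun (hlink : LinkWellDefined φ) {δ : ℝ}
    (hδ : 1 / 2 + δ ∈ Set.Ioo (0 : ℝ) 1) : margin φ δ = |linkFun φ (1 / 2 + δ)| := by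
  rw [margin, show (1 / 2 - δ : ℝ) = 1 - (1 / 2 + δ) by ring, linkFun_one_sub hlink hδ, abs_neg,
    max_eq_right (le_abs_self _)]

variable (hsign : ∀ μ ∈ Set.Ioo (0 : ℝ) 1, Real.sign (μ - 1 / 2) = Real.sign (linkFun φ μ))
  {δ : ℝ} (hδ : δ ∈ Set.Ioo (0 : ℝ) (1 / 2))
include hsign

theorem linkFun_pos (hμ : μ ∈ Set.Ioo (0 : ℝ) 1) (h : 1 / 2 < μ) : 0 < linkFun φ μ := by
  have hone : Real.sign (linkFun φ μ) = 1 := by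
    rw [← hsign μ hμ, Real.sign_of_pos (sub_pos.2 h)]
  have hne : linkFun φ μ ≠ 0 := fun h0 => by simp [h0] at hone
  simpa [hone] using Real.sign_mul_pos_of_ne_zero _ hne

include hδ

theorem linkFun_half_add_pos : 0 < linkFun φ (1 / 2 + δ) :=
  linkFun_pos hsign ⟨by linarith [hδ.1], by linarith [hδ.2]⟩ (by linarith [hδ.1])

theorem margin_pos : 0 < margin φ δ :=
  (linkFun_half_add_pos hsign hδ).trans_le (le_max_left _ _)

theorem margin_le_abs_linkFun (hlink : LinkWellDefined φ)
    (hmono : MonotoneOn (linkFun φ) (Set.Ioo (0 : ℝ) 1)) (hμ : μ ∈ Set.Ioo (0 : ℝ) 1)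
    (h : δ < |μ - 1 / 2|) : margin φ δ ≤ |linkFun φ μ| := by
  have hμδ : 1 / 2 + δ ∈ Set.Ioo (0 : ℝ) 1 := ⟨by linarith [hδ.1], by linarith [hδ.2]⟩
  rw [margin_eq_abs_linkFun hlink hμδ, abs_of_pos (linkFun_half_add_pos hsign hδ)]
  rcases lt_abs.1 h with hright | hleft
  · exact (hmono hμδ hμ (by linarith)).trans (le_abs_self _)
  · rw [← abs_neg, ← linkFun_one_sub hlink hμ]
    exact (hmono hμδ (one_sub_mem_Ioo hμ) (by linarith)).trans (le_abs_self _)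

end Link

section BayesRule

theorem Label.integral_eq (ν : Measure Label) [IsProbabilityMeasure ν] (F : Label → ℝ) :
    ∫ y, F y ∂ν
      = ν.real {Label.one} * F Label.one + (1 - ν.real {Label.one}) * F Label.negOne := by
  have hF : F = fun y =>
      Set.indicator {Label.one} (fun _ => F Label.one - F Label.negOne) y + F Label.negOne := by
    ext y
    rcases y.eq_one_or_eq_negOne with rfl | rfl
    · simp
    · have hne : Label.negOne ∉ ({Label.one} : Set Label) := by
        rw [Set.mem_singleton_iff, Label.negOne, Label.one, Subtype.mk.injEq]
        norm_num
      rw [Set.indicator_of_notMem hne, zero_add]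
  rw [hF, integral_add Integrable.of_finite Integrable.of_finite,
    integral_indicator_const _ (MeasurableSet.singleton _), integral_const, probReal_univ, ← hF]
  simp only [smul_eq_mul]
  ring

variable {X : Type*} [MeasurableSpace X] {ρ : Measure (X × Label)} [IsProbabilityMeasure ρ]
  {φ : ℝ → ℝ}

theorem measurable_condProb : Measurable (condProb ρ) :=
  (Kernel.measurable_coe _ (MeasurableSet.singleton _)).ennreal_toReal

theorem condMean_eq (x : X) : condMean ρ x = 2 * condProb ρ x - 1 := by
  rw [condMean, Label.integral_eq, condProb]
  simp only [Label.one, Label.negOne]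
  ring

theorem extRisk_eq_lintegral_condRisk (hφ0 : ∀ v, 0 ≤ φ v) (hφ : Measurable φ) {f : X → ℝ}
    (hf : Measurable f) :
    extRisk ρ φ f = ∫⁻ x, ENNReal.ofReal (condRisk φ (condProb ρ x) (f x)) ∂ρ.fst := by
  have hloss : Measurable fun z : X × Label => loss φ (f z.1) z.2 :=
    measurable_loss hφ (hf.comp measurable_fst) measurable_snd
  rw [extRisk, ← Measure.lintegral_condKernel hloss.ennreal_ofReal]
  refine lintegral_congr fun x => ?_
  rw [← ofReal_integral_eq_lintegral_ofReal (f := fun y => loss φ (f x) y) Integrable.of_finite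
    (Filter.Eventually.of_forall fun _ => hφ0 _), Label.integral_eq]
  simp [condRisk, condProb, loss, Label.one, Label.negOne]

theorem measurable_condRisk (hφ : Measurable φ) {f : X → ℝ} (hf : Measurable f) :
    Measurable fun x => condRisk φ (condProb ρ x) (f x) :=
  (measurable_condProb.mul (hφ.comp hf)).add
    ((measurable_const.sub measurable_condProb).mul (hφ.comp hf.neg))

theorem aemeasurable_comp_condProb_of_monotoneOn
    (hprob : ∀ᵐ x ∂ρ.fst, condProb ρ x ∈ Set.Ioo (0 : ℝ) 1) {ℓ : ℝ → ℝ}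
    (hℓ : MonotoneOn ℓ (Set.Ioo (0 : ℝ) 1)) : AEMeasurable (fun x => ℓ (condProb ρ x)) ρ.fst := by
  have hmem : ∀ᵐ μ ∂ρ.fst.map (condProb ρ), μ ∈ Set.Ioo (0 : ℝ) 1 :=
    (ae_map_iff measurable_condProb.aemeasurable measurableSet_Ioo).2 hprob
  have hrestrict := aemeasurable_restrict_of_monotoneOn (μ := ρ.fst.map (condProb ρ))
    measurableSet_Ioo hℓ
  rw [Measure.restrict_eq_self_of_ae_mem hmem] at hrestrict
  exact hrestrict.comp_measurable measurable_condProb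

theorem IsBayesRule.ae_eq_linkFun (hφ0 : ∀ v, 0 ≤ φ v) (hφ : Measurable φ)
    (hprob : ∀ᵐ x ∂ρ.fst, condProb ρ x ∈ Set.Ioo (0 : ℝ) 1) (hlink : LinkWellDefined φ)
    (hmeas : AEMeasurable (fun x => linkFun φ (condProb ρ x)) ρ.fst) {f : X → ℝ}
    (hf : IsBayesRule ρ φ f) (hfin : extRisk ρ φ f ≠ ⊤) :
    ∀ᵐ x ∂ρ.fst, f x = linkFun φ (condProb ρ x) := by
  obtain ⟨ℓ, hℓ, hℓlink⟩ := hmeas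
  have hle := hf.2 ℓ hℓ
  rw [extRisk_eq_lintegral_condRisk hφ0 hφ hf.1] at hle hfin
  rw [extRisk_eq_lintegral_condRisk hφ0 hφ hℓ] at hle
  have hpt : (fun x => ENNReal.ofReal (condRisk φ (condProb ρ x) (ℓ x)))
      ≤ᵐ[ρ.fst] fun x => ENNReal.ofReal (condRisk φ (condProb ρ x) (f x)) := by
    filter_upwards [hprob, hℓlink] with x hx hxℓ
    rw [← hxℓ]
    exact ENNReal.ofReal_le_ofReal (condRisk_linkFun_le hlink hx _)
  have heq := ae_eq_of_ae_le_of_lintegral_le hpt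
    (ne_top_of_le_ne_top hfin (lintegral_mono_ae hpt))
    (measurable_condRisk hφ hf.1).ennreal_ofReal.aemeasurable hle
  filter_upwards [hprob, hℓlink, heq] with x hx hxℓ hxe
  rw [← hxℓ,
    ENNReal.ofReal_eq_ofReal_iff (condRisk_nonneg hφ0 hx _) (condRisk_nonneg hφ0 hx _)] at hxe
  exact eq_linkFun_of_condRisk_le hlink hx hxe.ge

end BayesRule

section ClassError

variable {X : Type*} [MeasurableSpace X] {ρ : Measure (X × Label)}

theorem zeroOne_mem_Icc (y y' : ℝ) : zeroOne y y' ∈ Set.Icc (0 : ℝ) 1 := by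
  unfold zeroOne; split_ifs <;> norm_num

theorem classError_congr {f g : X → ℝ} (h : ∀ᵐ x ∂ρ.fst, Real.sign (f x) = Real.sign (g x)) :
    classError ρ f = classError ρ g := by
  refine integral_congr_ae ?_
  filter_upwards [ae_of_ae_map measurable_fst.aemeasurable h] with z hz
  simp only [hz]

theorem sign_eq_of_abs_sub_lt {a b : ℝ} (h : |a - b| < |b|) : Real.sign a = Real.sign b := by
  obtain ⟨hlo, hhi⟩ := abs_lt.1 h
  rcases lt_or_ge b 0 with hb | hb
  · rw [abs_of_neg hb] at hhi
    rw [Real.sign_of_neg hb, Real.sign_of_neg (by linarith)]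
  · rw [abs_of_nonneg hb] at hlo hhi
    rw [Real.sign_of_pos (by linarith), Real.sign_of_pos (by linarith)]

theorem measurable_sign : Measurable Real.sign :=
  Measurable.ite measurableSet_Iio measurable_const
    (Measurable.ite measurableSet_Ioi measurable_const measurable_const)

variable [IsProbabilityMeasure ρ]

theorem classError_mem_Icc (f : X → ℝ) : classError ρ f ∈ Set.Icc (0 : ℝ) 1 := by
  refine ⟨integral_nonneg fun _ => (zeroOne_mem_Icc _ _).1, ?_⟩
  simpa [classError] using integral_mono_of_nonneg (μ := ρ)
    (Filter.Eventually.of_forall fun z => (zeroOne_mem_Icc (Real.sign (f z.1)) z.2).1)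
    (integrable_const 1) (Filter.Eventually.of_forall fun z => (zeroOne_mem_Icc _ _).2)

theorem measurable_classError {α : Type*} [MeasurableSpace α] {f : α → X → ℝ}
    (hf : Measurable fun q : α × X => f q.1 q.2) : Measurable fun a => classError ρ (f a) := by
  have hsign : Measurable fun q : α × (X × Label) => Real.sign (f q.1 q.2.1) :=
    measurable_sign.comp (hf.comp (measurable_fst.prodMk (measurable_fst.comp measurable_snd)))
  have hlabel : Measurable fun q : α × (X × Label) => (q.2.2 : ℝ) :=
    measurable_subtype_coe.comp (measurable_snd.comp measurable_snd)
  have hzeroOne : Measurable fun q : α × (X × Label) =>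
      zeroOne (Real.sign (f q.1 q.2.1)) (q.2.2 : ℝ) :=
    Measurable.ite (measurableSet_eq_fun hsign hlabel).compl measurable_const measurable_const
  exact hzeroOne.stronglyMeasurable.integral_prod_right'.measurable

theorem sign_condMean (x : X) :
    Real.sign (condMean ρ x) = Real.sign (condProb ρ x - 1 / 2) := by
  rw [condMean_eq]
  rcases lt_trichotomy (condProb ρ x - 1 / 2) 0 with h | h | h
  · rw [Real.sign_of_neg h, Real.sign_of_neg (by linarith)]
  · rw [h, show 2 * condProb ρ x - 1 = 0 by linarith]
  · rw [Real.sign_of_pos h, Real.sign_of_pos (by linarith)]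

variable {φ : ℝ → ℝ} {δ : ℝ}

theorem ae_margin_le_abs_and_sign_eq (hδ : δ ∈ Set.Ioo (0 : ℝ) (1 / 2))
    (hnoise : ∀ᵐ x ∂ρ.fst, δ < |condProb ρ x - 1 / 2|)
    (hprob : ∀ᵐ x ∂ρ.fst, condProb ρ x ∈ Set.Ioo (0 : ℝ) 1) (hlink : LinkWellDefined φ)
    (hmono : MonotoneOn (linkFun φ) (Set.Ioo (0 : ℝ) 1))
    (hsign : ∀ μ ∈ Set.Ioo (0 : ℝ) 1, Real.sign (μ - 1 / 2) = Real.sign (linkFun φ μ))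
    {q : X → ℝ} (hq : ∀ᵐ x ∂ρ.fst, q x = linkFun φ (condProb ρ x)) :
    ∀ᵐ x ∂ρ.fst, margin φ δ ≤ |q x| ∧ Real.sign (q x) = Real.sign (condMean ρ x) := by
  filter_upwards [hnoise, hprob, hq] with x hδx hx hqx
  rw [hqx, sign_condMean, hsign _ hx]
  exact ⟨margin_le_abs_linkFun hsign hδ hlink hmono hx hδx, rfl⟩

end ClassError

section ProductMeasure

variable {ι : Type*} [DecidableEq ι] {S : ι → Type*} [∀ i, MeasurableSpace (S i)]
  (μ : ∀ i, Measure (S i)) [∀ i, IsProbabilityMeasure (μ i)]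

theorem map_update_infinitePi_prod (k : ι) :
    ((Measure.infinitePi μ).prod (μ k)).map (fun q => Function.update q.1 k q.2)
      = Measure.infinitePi μ := by
  refine Measure.eq_infinitePi μ fun s t ht => ?_
  have hpi : MeasurableSet (Set.pi s t) := .pi s.countable_toSet fun i _ => ht i
  rw [Measure.map_apply measurable_update' hpi]
  by_cases hk : k ∈ s
  · have hpre : (fun q : (∀ i, S i) × S k => Function.update q.1 k q.2) ⁻¹' Set.pi s t
        = Set.pi (s.erase k : Finset ι) t ×ˢ t k := by
      ext q
      grind [Function.update]
    rw [hpre, Measure.prod_prod, Measure.infinitePi_pi _ fun i _ => ht i,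
      Finset.prod_erase_mul _ _ hk]
  · have hpre : (fun q : (∀ i, S i) × S k => Function.update q.1 k q.2) ⁻¹' Set.pi s t
        = Set.pi s t ×ˢ Set.univ := by
      have hne : ∀ i ∈ s, i ≠ k := fun i hi => ne_of_mem_of_not_mem hi hk
      ext q
      simp +contextual [hne]
    rw [hpre, Measure.prod_prod, Measure.infinitePi_pi _ fun i _ => ht i, measure_univ, mul_one]

theorem lintegral_infinitePi_eq_lintegral_update (k : ι) {f : (∀ i, S i) → ENNReal}
    (hf : Measurable f) :
    ∫⁻ z, f z ∂Measure.infinitePi μ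
      = ∫⁻ z, ∫⁻ x, f (Function.update z k x) ∂μ k ∂Measure.infinitePi μ := by
  rw [← lintegral_prod (fun q : (∀ i, S i) × S k => f (Function.update q.1 k q.2))
      (hf.comp measurable_update').aemeasurable,
    ← lintegral_map hf measurable_update', map_update_infinitePi_prod]

end ProductMeasure

section Sampling

variable {S : Type*} [MeasurableSpace S] {ρ : Measure S} [IsProbabilityMeasure ρ]

theorem lintegral_infinitePi_le_pow_mul {Φ : ℕ → (ℕ → S) → ENNReal} (hΦ : ∀ n, Measurable (Φ n))
    {c : ENNReal} {N : ℕ} (hstep : ∀ n < N, ∀ z : ℕ → S,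
      ∫⁻ x, Φ (n + 1) (Function.update z (n + 1) x) ∂ρ ≤ c * Φ n z) {n : ℕ} (hn : n ≤ N) :
    ∫⁻ z, Φ n z ∂Measure.infinitePi (fun _ : ℕ => ρ)
      ≤ c ^ n * ∫⁻ z, Φ 0 z ∂Measure.infinitePi (fun _ : ℕ => ρ) := by
  induction n with
  | zero => simp
  | succ n ih =>
    calc ∫⁻ z, Φ (n + 1) z ∂Measure.infinitePi (fun _ : ℕ => ρ)
        = ∫⁻ z, ∫⁻ x, Φ (n + 1) (Function.update z (n + 1) x) ∂ρ
            ∂Measure.infinitePi (fun _ : ℕ => ρ) :=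
          lintegral_infinitePi_eq_lintegral_update (fun _ => ρ) (n + 1) (hΦ (n + 1))
      _ ≤ ∫⁻ z, c * Φ n z ∂Measure.infinitePi (fun _ : ℕ => ρ) := lintegral_mono (hstep n hn)
      _ = c * ∫⁻ z, Φ n z ∂Measure.infinitePi (fun _ : ℕ => ρ) := lintegral_const_mul _ (hΦ n)
      _ ≤ c * (c ^ n * ∫⁻ z, Φ 0 z ∂Measure.infinitePi (fun _ : ℕ => ρ)) := by
          gcongr
          exact ih (Nat.le_of_succ_le hn)
      _ = c ^ (n + 1) * ∫⁻ z, Φ 0 z ∂Measure.infinitePi (fun _ : ℕ => ρ) := by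
          rw [pow_succ', mul_assoc]

end Sampling

section Concentration

variable {S : Type*} [MeasurableSpace S] {ρ : Measure S}

theorem measure_real_le_exp_of_lintegral_exp_le {f : S → ℝ} (hf : Measurable f) {D : ℝ}
    (hD : ∫⁻ z, ENNReal.ofReal (Real.exp (f z)) ∂ρ ≤ ENNReal.ofReal (Real.exp D)) (A : ℝ) :
    ρ.real {z | A ≤ f z} ≤ Real.exp (D - A) := by
  have hmarkov := mul_meas_ge_le_lintegral₀ hf.exp.ennreal_ofReal.aemeasurable (μ := ρ)
    (ENNReal.ofReal (Real.exp A))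
  simp only [ENNReal.ofReal_le_ofReal_iff (Real.exp_pos _).le, Real.exp_le_exp] at hmarkov
  have hreal := ENNReal.toReal_mono ENNReal.ofReal_ne_top (hmarkov.trans hD)
  rw [ENNReal.toReal_mul, ENNReal.toReal_ofReal (Real.exp_pos _).le,
    ENNReal.toReal_ofReal (Real.exp_pos _).le] at hreal
  rwa [Real.exp_sub, le_div_iff₀ (Real.exp_pos A), mul_comm]

variable [IsProbabilityMeasure ρ]

theorem lintegral_exp_mul_sub_integral_le {U : S → ℝ} (hU : AEMeasurable U ρ) {m σ : ℝ}
    (hb : ∀ z, |U z - m| ≤ σ) (t : ℝ) :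
    ∫⁻ z, ENNReal.ofReal (Real.exp (t * (U z - ∫ w, U w ∂ρ))) ∂ρ
      ≤ ENNReal.ofReal (Real.exp (t ^ 2 * σ ^ 2 / 2)) := by
  have hmem : ∀ᵐ z ∂ρ, U z ∈ Set.Icc (m - σ) (m + σ) := Filter.Eventually.of_forall fun z =>
    ⟨by linarith [(abs_le.1 (hb z)).1], by linarith [(abs_le.1 (hb z)).2]⟩
  have hsub := hasSubgaussianMGF_of_mem_Icc hU hmem
  rw [← ofReal_integral_eq_lintegral_ofReal (hsub.integrable_exp_mul t)
    (Filter.Eventually.of_forall fun _ => (Real.exp_pos _).le)]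
  refine ENNReal.ofReal_le_ofReal ((hsub.mgf_le t).trans_eq ?_)
  congr 1
  push_cast
  rw [Real.norm_eq_abs, div_pow, sq_abs]
  ring

variable {H : Type*} [NormedAddCommGroup H] [InnerProductSpace ℝ H]

theorem lintegral_exp_norm_sub_smul_sq_le {G : S → H} (hG : AEStronglyMeasurable G ρ) {v : H}
    {lam B m σ η s : ℝ} (hη : 0 ≤ η) (hs : 0 ≤ s)
    (hdrift : lam * ‖v‖ ^ 2 ≤ ∫ z, inner ℝ v (G z) ∂ρ) (hB : ∀ z, ‖G z‖ ≤ B)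
    (hσ : ∀ z, |inner ℝ v (G z) - m| ≤ σ) :
    ∫⁻ z, ENNReal.ofReal (Real.exp (s * ‖v - η • G z‖ ^ 2)) ∂ρ
      ≤ ENNReal.ofReal (Real.exp
          (s * ((1 - 2 * η * lam) * ‖v‖ ^ 2 + η ^ 2 * B ^ 2) + 2 * (s * η * σ) ^ 2)) := by
  set a := s * ((1 - 2 * η * lam) * ‖v‖ ^ 2 + η ^ 2 * B ^ 2)
  have hpt : ∀ z, s * ‖v - η • G z‖ ^ 2
      ≤ a + -(2 * s * η) * (inner ℝ v (G z) - ∫ w, inner ℝ v (G w) ∂ρ) := by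
    intro z
    have hG2 : ‖G z‖ ^ 2 ≤ B ^ 2 := pow_le_pow_left₀ (norm_nonneg _) (hB z) 2
    have hstep : ‖v - η • G z‖ ^ 2 ≤ ‖v‖ ^ 2 - 2 * η * inner ℝ v (G z) + η ^ 2 * B ^ 2 := by
      rw [norm_sub_sq_real, real_inner_smul_right, norm_smul, mul_pow, Real.norm_eq_abs, sq_abs]
      nlinarith [mul_le_mul_of_nonneg_left hG2 (sq_nonneg η)]
    have hstep' := mul_le_mul_of_nonneg_left hstep hs
    have hdrift' := mul_le_mul_of_nonneg_left hdrift (mul_nonneg hs hη)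
    simp only [a]
    linarith
  calc ∫⁻ z, ENNReal.ofReal (Real.exp (s * ‖v - η • G z‖ ^ 2)) ∂ρ
      ≤ ∫⁻ z, ENNReal.ofReal (Real.exp a) * ENNReal.ofReal
          (Real.exp (-(2 * s * η) * (inner ℝ v (G z) - ∫ w, inner ℝ v (G w) ∂ρ))) ∂ρ := by
        refine lintegral_mono fun z => ?_
        rw [← ENNReal.ofReal_mul (Real.exp_pos _).le, ← Real.exp_add]
        exact ENNReal.ofReal_le_ofReal (Real.exp_le_exp.2 (hpt z))
    _ = ENNReal.ofReal (Real.exp a) * ∫⁻ z, ENNReal.ofReal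
          (Real.exp (-(2 * s * η) * (inner ℝ v (G z) - ∫ w, inner ℝ v (G w) ∂ρ))) ∂ρ :=
        lintegral_const_mul' _ _ ENNReal.ofReal_ne_top
    _ ≤ ENNReal.ofReal (Real.exp a)
          * ENNReal.ofReal (Real.exp ((-(2 * s * η)) ^ 2 * σ ^ 2 / 2)) := by
        gcongr
        exact lintegral_exp_mul_sub_integral_le (hG.const_inner (c := v)).aemeasurable hσ _
    _ = ENNReal.ofReal (Real.exp (a + 2 * (s * η * σ) ^ 2)) := by
        rw [← ENNReal.ofReal_mul (Real.exp_pos _).le, ← Real.exp_add]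
        ring_nf

end Concentration

section StochasticGradient

variable {X H : Type*} [NormedAddCommGroup H] [InnerProductSpace ℝ H] [CompleteSpace H]
  [RKHS ℝ H X ℝ] {φ : ℝ → ℝ} {lam M R : ℝ}

theorem norm_dloss_smul_feature_le (hM : ∀ (ζ : ℝ) (y : Label), |dloss φ ζ y| ≤ M)
    (hF : ∀ x : X, ‖feature H x‖ ≤ R) (ζ : ℝ) (y : Label) (x : X) :
    ‖dloss φ ζ y • feature H x‖ ≤ M * R := by
  rw [norm_smul, Real.norm_eq_abs]
  exact mul_le_mul (hM ζ y) (hF x) (norm_nonneg _) ((abs_nonneg _).trans (hM ζ y))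

theorem norm_stochGrad_le (hlam : 0 < lam) (hM : ∀ (ζ : ℝ) (y : Label), |dloss φ ζ y| ≤ M)
    (hF : ∀ x : X, ‖feature H x‖ ≤ R) {g : H} (hg : ‖g‖ ≤ 2 * (M * R) / lam) (z : X × Label) :
    ‖stochGrad φ lam g z‖ ≤ 3 * (M * R) := by
  have hreg : ‖lam • g‖ ≤ 2 * (M * R) := by
    rwa [norm_smul, Real.norm_eq_abs, abs_of_pos hlam, ← le_div_iff₀' hlam]
  calc ‖stochGrad φ lam g z‖ ≤ ‖dloss φ (g z.1) z.2 • feature H z.1‖ + ‖lam • g‖ :=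
        norm_add_le _ _
    _ ≤ M * R + 2 * (M * R) := add_le_add (norm_dloss_smul_feature_le hM hF _ _ _) hreg
    _ = 3 * (M * R) := by ring

theorem inner_sub_stochGrad (p g : H) (z : X × Label) :
    inner ℝ (g - p) (stochGrad φ lam g z)
      = dloss φ (g z.1) z.2 * (g z.1 - p z.1) + lam * inner ℝ g (g - p) := by
  rw [real_inner_comm, stochGrad, inner_add_left, real_inner_smul_left, real_inner_smul_left,
    inner_feature, RKHS.coe_sub, Pi.sub_apply]

theorem abs_inner_sub_stochGrad_sub_le (hM : ∀ (ζ : ℝ) (y : Label), |dloss φ ζ y| ≤ M)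
    (hF : ∀ x : X, ‖feature H x‖ ≤ R) (p g : H) (z : X × Label) :
    |inner ℝ (g - p) (stochGrad φ lam g z) - lam * inner ℝ g (g - p)| ≤ M * R * ‖g - p‖ := by
  rw [inner_sub_stochGrad, add_sub_cancel_right, abs_mul, mul_assoc]
  exact mul_le_mul (hM _ _) (abs_apply_sub_le hF g p z.1) (abs_nonneg _)
    ((abs_nonneg _).trans (hM 0 z.2))

theorem norm_sgd_le (hlam : 0 < lam) (hM : ∀ (ζ : ℝ) (y : Label), |dloss φ ζ y| ≤ M)
    (hF : ∀ x : X, ‖feature H x‖ ≤ R) {η : ℕ → ℝ} (hη0 : ∀ n, 0 ≤ η (n + 1))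
    (hη : ∀ n, lam * η (n + 1) ≤ 1) {g₁ : H} (hg₁ : ‖g₁‖ ≤ 2 * (M * R) / lam)
    (z : ℕ → X × Label) (n : ℕ) : ‖sgd φ lam η g₁ z n‖ ≤ 2 * (M * R) / lam := by
  induction n with
  | zero => exact hg₁
  | succ n ih =>
    set g := sgd φ lam η g₁ z n
    set v : H := dloss φ (g (z (n + 1)).1) (z (n + 1)).2 • feature H (z (n + 1)).1
    have hv : ‖v‖ ≤ M * R := norm_dloss_smul_feature_le hM hF _ _ _
    have hMR : 0 ≤ M * R := (norm_nonneg v).trans hv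
    have hshrink : 0 ≤ 1 - lam * η (n + 1) := sub_nonneg.2 (hη n)
    have hsgd : sgd φ lam η g₁ z (n + 1) = (1 - lam * η (n + 1)) • g - η (n + 1) • v := by
      simp only [sgd, stochGrad, g, v]
      module
    calc ‖sgd φ lam η g₁ z (n + 1)‖
        ≤ (1 - lam * η (n + 1)) * ‖g‖ + η (n + 1) * ‖v‖ := by
          rw [hsgd]
          refine (norm_sub_le _ _).trans_eq ?_
          rw [norm_smul, norm_smul, Real.norm_of_nonneg hshrink, Real.norm_of_nonneg (hη0 n)]
      _ ≤ (1 - lam * η (n + 1)) * (2 * (M * R) / lam) + η (n + 1) * (M * R) :=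
          add_le_add (mul_le_mul_of_nonneg_left ih hshrink)
            (mul_le_mul_of_nonneg_left hv (hη0 n))
      _ = 2 * (M * R) / lam - η (n + 1) * (M * R) := by
          field_simp
          ring
      _ ≤ 2 * (M * R) / lam := sub_le_self _ (mul_nonneg (hη0 n) hMR)

theorem sgd_update_of_lt (η : ℕ → ℝ) (g₁ : H) (z : ℕ → X × Label) (x : X × Label) {n k : ℕ}
    (h : n < k) : sgd φ lam η g₁ (Function.update z k x) n = sgd φ lam η g₁ z n := by
  induction n with
  | zero => rfl
  | succ n ih => simp only [sgd, ih (Nat.lt_of_succ_lt h), Function.update_of_ne h.ne]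

theorem sgd_succ_update (η : ℕ → ℝ) (g₁ : H) (z : ℕ → X × Label) (x : X × Label) (n : ℕ) :
    sgd φ lam η g₁ (Function.update z (n + 1) x) (n + 1)
      = sgd φ lam η g₁ z n - η (n + 1) • stochGrad φ lam (sgd φ lam η g₁ z n) x := by
  rw [sgd, sgd_update_of_lt η g₁ z x n.lt_succ_self, Function.update_self]

variable [MeasurableSpace X]

theorem stronglyMeasurable_stochGrad (hk : StronglyMeasurable (fun x : X => feature H x))
    (hφ : Differentiable ℝ φ) {α : Type*} [MeasurableSpace α] {g : α → H}
    (hg : StronglyMeasurable g) {s : α → X × Label} (hs : Measurable s) :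
    StronglyMeasurable fun a => stochGrad φ lam (g a) (s a) := by
  have hfeature : StronglyMeasurable fun a => feature H (s a).1 :=
    hk.comp_measurable (measurable_fst.comp hs)
  have hdloss : Measurable fun a => dloss φ (g a (s a).1) (s a).2 := by
    simp only [← inner_feature (H := H)]
    exact measurable_dloss hφ (hfeature.inner hg).measurable (measurable_snd.comp hs)
  exact (hdloss.stronglyMeasurable.smul hfeature).add (hg.const_smul lam)

theorem stronglyMeasurable_sgd (hk : StronglyMeasurable (fun x : X => feature H x))
    (hφ : Differentiable ℝ φ) (η : ℕ → ℝ) (g₁ : H) (n : ℕ) :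
    StronglyMeasurable fun z : ℕ → X × Label => sgd φ lam η g₁ z n := by
  induction n with
  | zero => exact stronglyMeasurable_const
  | succ n ih =>
    exact ih.sub ((stronglyMeasurable_stochGrad hk hφ ih (measurable_pi_apply _)).const_smul _)

theorem stronglyMeasurable_avgSgd (hk : StronglyMeasurable (fun x : X => feature H x))
    (hφ : Differentiable ℝ φ) (η α : ℕ → ℝ) (g₁ : H) (T : ℕ) :
    StronglyMeasurable fun z : ℕ → X × Label => avgSgd φ lam η α g₁ T z :=
  Finset.stronglyMeasurable_fun_sum _ fun n _ =>
    (stronglyMeasurable_sgd hk hφ η g₁ n).const_smul _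

variable {ρ : Measure (X × Label)} [IsProbabilityMeasure ρ]

theorem integrable_inner_sub_stochGrad (hk : StronglyMeasurable (fun x : X => feature H x))
    (hφ : Differentiable ℝ φ) (hM : ∀ (ζ : ℝ) (y : Label), |dloss φ ζ y| ≤ M)
    (hF : ∀ x : X, ‖feature H x‖ ≤ R) (p g : H) :
    Integrable (fun z => inner ℝ (g - p) (stochGrad φ lam g z)) ρ := by
  have hmeas : StronglyMeasurable fun z : X × Label => inner ℝ (g - p) (stochGrad φ lam g z) :=
    stronglyMeasurable_const.inner
      (stronglyMeasurable_stochGrad hk hφ stronglyMeasurable_const measurable_id)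
  have hnoise : Integrable
      (fun z => inner ℝ (g - p) (stochGrad φ lam g z) - lam * inner ℝ g (g - p)) ρ :=
    .of_bound (hmeas.sub stronglyMeasurable_const).aestronglyMeasurable (M * R * ‖g - p‖)
      (.of_forall fun z => abs_inner_sub_stochGrad_sub_le hM hF p g z)
  exact (hnoise.add (integrable_const (lam * inner ℝ g (g - p)))).congr
    (.of_forall fun z => sub_add_cancel _ _)

theorem mul_norm_sub_sq_le_integral_inner_sub_stochGrad
    (hk : StronglyMeasurable (fun x : X => feature H x)) (hφ : Differentiable ℝ φ)
    (hc : ConvexOn ℝ Set.univ φ) (hM : ∀ (ζ : ℝ) (y : Label), |dloss φ ζ y| ≤ M)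
    (hF : ∀ x : X, ‖feature H x‖ ≤ R) {p : H}
    (hp : IsMinOn (tikhonov (risk ρ φ) lam) Set.univ p) (g : H) :
    lam * ‖g - p‖ ^ 2 ≤ ∫ z, inner ℝ (g - p) (stochGrad φ lam g z) ∂ρ := by
  have hLip := lipschitzWith_of_abs_dloss_le hφ hM
  have hloss := fun g : H => integrable_loss (ρ := ρ) hk hLip hF g
  have hgrowth := strongConvexOn_quadratic_growth
    (strongConvexOn_tikhonov (convexOn_risk (ρ := ρ) hk hLip hc hF) lam)
    (Set.mem_univ p) (Set.mem_univ g) hp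
  have hsubgrad : risk ρ φ g - risk ρ φ p
      ≤ (∫ z, inner ℝ (g - p) (stochGrad φ lam g z) ∂ρ) - lam * inner ℝ g (g - p) := by
    have hint := integrable_inner_sub_stochGrad (ρ := ρ) (lam := lam) hk hφ hM hF p g
    calc risk ρ φ g - risk ρ φ p = ∫ z, (loss φ (g z.1) z.2 - loss φ (p z.1) z.2) ∂ρ :=
          (integral_sub (hloss g) (hloss p)).symm
      _ ≤ ∫ z, (inner ℝ (g - p) (stochGrad φ lam g z) - lam * inner ℝ g (g - p)) ∂ρ := by
          refine integral_mono ((hloss g).sub (hloss p)) (hint.sub (integrable_const _))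
            fun z => ?_
          rw [inner_sub_stochGrad, add_sub_cancel_right]
          linarith [loss_add_dloss_mul_sub_le hφ hc (g z.1) (p z.1) z.2]
      _ = _ := by
          rw [integral_sub hint (integrable_const _), integral_const, probReal_univ, one_smul]
  have hinner : inner ℝ g (g - p) = (‖g‖ ^ 2 + ‖g - p‖ ^ 2 - ‖p‖ ^ 2) / 2 := by
    rw [norm_sub_sq_real, inner_sub_right, real_inner_self_eq_norm_sq]
    ring
  simp only [tikhonov] at hgrowth
  rw [hinner] at hsubgrad
  linarith

end StochasticGradient

section Schedule

variable {lam γ c : ℝ}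

theorem stepSize_nonneg (hlam : 0 ≤ lam) (hγ : 0 ≤ γ) (n : ℕ) : 0 ≤ stepSize lam γ n := by
  rw [stepSize]
  positivity

theorem mul_stepSize_succ_le_one (hlam : 0 < lam) (hγ : 1 ≤ γ) (n : ℕ) :
    lam * stepSize lam γ (n + 1) ≤ 1 := by
  have : (0 : ℝ) ≤ n := n.cast_nonneg
  rw [stepSize, mul_div_assoc', mul_div_mul_left _ _ hlam.ne', div_le_one (by positivity)]
  push_cast
  linarith

/-- The weight `λ² (γ + n - 1) (γ + n) / 4` given to the squared distance between the iterate
`g_{n+1}` and the regularized minimizer: the telescoping factor of the recursion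
`a ↦ (1 - 2 η_{n+1} λ) a`. -/
def sgdWeight (lam γ : ℝ) (n : ℕ) : ℝ := lam ^ 2 * (γ + n - 1) * (γ + n) / 4

theorem sgdWeight_nonneg (hγ : 1 ≤ γ) (n : ℕ) : 0 ≤ sgdWeight lam γ n := by
  have : (0 : ℝ) ≤ n := n.cast_nonneg
  have hγn : 0 ≤ γ + n - 1 := by linarith
  rw [sgdWeight]
  positivity

theorem sgdWeight_succ_mul_stepSize (hlam : 0 < lam) (hγ : 0 < γ) (n : ℕ) :
    sgdWeight lam γ (n + 1) * stepSize lam γ (n + 1) = lam * (γ + n) / 2 := by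
  have hγn : γ + n + 1 ≠ 0 := by positivity
  rw [sgdWeight, stepSize]
  push_cast
  rw [← add_assoc, add_sub_cancel_right]
  field_simp
  norm_num

theorem sgdWeight_succ_mul_one_sub (hlam : 0 < lam) (hγ : 0 < γ) (n : ℕ) :
    sgdWeight lam γ (n + 1) * (1 - 2 * stepSize lam γ (n + 1) * lam)
      = sgdWeight lam γ n - lam ^ 2 / 2 * (γ + n) := by
  have hstep := sgdWeight_succ_mul_stepSize hlam hγ n
  have hweight : sgdWeight lam γ (n + 1) = sgdWeight lam γ n + lam ^ 2 / 2 * (γ + n) := by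
    rw [sgdWeight, sgdWeight]
    push_cast
    ring
  linear_combination hweight - 2 * lam * hstep

theorem sgdWeight_succ_mul_stepSize_sq_le_one (hlam : 0 < lam) (hγ : 0 < γ) (n : ℕ) :
    sgdWeight lam γ (n + 1) * stepSize lam γ (n + 1) ^ 2 ≤ 1 := by
  have : 0 < γ + n + 1 := by positivity
  rw [sq, ← mul_assoc, sgdWeight_succ_mul_stepSize hlam hγ, stepSize]
  push_cast
  rw [← add_assoc, div_mul_div_comm, div_le_one (by positivity)]
  linarith

theorem sq_sgdWeight_succ_mul_stepSize_le (hlam : 0 < lam) (hγ : 3 ≤ γ) (n : ℕ) :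
    (sgdWeight lam γ (n + 1) * stepSize lam γ (n + 1)) ^ 2 ≤ 3 / 2 * sgdWeight lam γ n := by
  have : (0 : ℝ) ≤ n := n.cast_nonneg
  have hgap : 0 ≤ lam ^ 2 * (γ + n) * (γ + n - 3) :=
    mul_nonneg (by positivity) (by linarith)
  rw [sgdWeight_succ_mul_stepSize hlam (by linarith), sgdWeight]
  linarith

/-- The tilt `1 / (3 c (T + n + 1))` of the exponential moment at step `n`. It decreases fast
enough to absorb the Hoeffding term of each step (`sgdTilt_succ_add_le`), yet only by a factor of
two over the `T + 1` steps. -/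
def sgdTilt (c : ℝ) (T n : ℕ) : ℝ := 1 / (3 * c * (T + n + 1))

theorem sgdTilt_nonneg (hc : 0 ≤ c) (T n : ℕ) : 0 ≤ sgdTilt c T n := by
  rw [sgdTilt]
  positivity

theorem sgdTilt_succ_add_le (hc : 0 < c) (T n : ℕ) :
    sgdTilt c T (n + 1) + 3 * c * sgdTilt c T (n + 1) ^ 2 ≤ sgdTilt c T n := by
  set x : ℝ := T + n + 1 with hx
  have hx0 : 0 < x := by positivity
  have hsucc : sgdTilt c T (n + 1) = 1 / (3 * c * (x + 1)) := by
    rw [sgdTilt, hx]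
    push_cast
    ring
  have hsum : 1 / (3 * c * (x + 1)) + 3 * c * (1 / (3 * c * (x + 1))) ^ 2
      = (x + 2) / (3 * c * (x + 1) ^ 2) := by
    field_simp
    ring
  rw [hsucc, hsum, sgdTilt, ← hx, div_le_div_iff₀ (by positivity) (by positivity)]
  linarith

theorem le_sgdTilt (hc : 0 < c) {T n : ℕ} (hn : n ≤ T + 1) :
    1 / (6 * c * (T + 1)) ≤ sgdTilt c T n := by
  have hn' : (n : ℝ) ≤ T + 1 := by exact_mod_cast hn
  rw [sgdTilt]
  refine one_div_le_one_div_of_le (by positivity) ?_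
  linarith [mul_le_mul_of_nonneg_left hn' hc.le]

theorem mul_sgdTilt_le (hc : 0 < c) (T n : ℕ) : 9 * c * sgdTilt c T n ≤ 3 / (T + 1) := by
  rw [sgdTilt, mul_one_div, div_le_div_iff₀ (by positivity) (by positivity)]
  linarith [mul_nonneg hc.le n.cast_nonneg]

theorem sum_range_add_cast (γ : ℝ) (T : ℕ) :
    ∑ n ∈ Finset.range (T + 1), (γ + n) = (2 * γ + T) * (T + 1) / 2 := by
  induction T with
  | zero => simp
  | succ T ih =>
    rw [Finset.sum_range_succ, ih]
    push_cast
    ring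

theorem avgWeight_succ (γ : ℝ) (T n : ℕ) :
    avgWeight γ T (n + 1) = 2 * (γ + n) / ((2 * γ + T) * (T + 1)) := by
  rw [avgWeight]
  push_cast
  ring

theorem sum_avgWeight (hγ : 0 < γ) (T : ℕ) :
    ∑ n ∈ Finset.range (T + 1), avgWeight γ T (n + 1) = 1 := by
  simp only [avgWeight_succ]
  rw [← Finset.sum_div, ← Finset.mul_sum, sum_range_add_cast]
  have : 0 < 2 * γ + T := by positivity
  field_simp

end Schedule

section Energy

variable {X H : Type*} [NormedAddCommGroup H] [InnerProductSpace ℝ H] [CompleteSpace H]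
  [RKHS ℝ H X ℝ] {φ : ℝ → ℝ} {lam M R γ c : ℝ} {g₁ p : H}

theorem norm_avgSgd_sub_sq_le (hγ : 0 < γ) (η : ℕ → ℝ) (g₁ p : H) (T : ℕ) (z : ℕ → X × Label) :
    (2 * γ + T) * (T + 1) / 2 * ‖avgSgd φ lam η (avgWeight γ T) g₁ T z - p‖ ^ 2
      ≤ ∑ n ∈ Finset.range (T + 1), (γ + n) * ‖sgd φ lam η g₁ z n - p‖ ^ 2 := by
  have : 0 < 2 * γ + T := by positivity
  have hsum := sum_avgWeight hγ T
  have havg : avgSgd φ lam η (avgWeight γ T) g₁ T z - p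
      = ∑ n ∈ Finset.range (T + 1), avgWeight γ T (n + 1) • (sgd φ lam η g₁ z n - p) := by
    simp only [smul_sub, Finset.sum_sub_distrib, ← Finset.sum_smul, hsum, one_smul, avgSgd]
  have hconv : ConvexOn ℝ Set.univ fun g : H => ‖g‖ ^ 2 :=
    (convexOn_norm convex_univ).pow (fun _ _ => norm_nonneg _) 2
  have hjensen : ‖avgSgd φ lam η (avgWeight γ T) g₁ T z - p‖ ^ 2
      ≤ ∑ n ∈ Finset.range (T + 1), avgWeight γ T (n + 1) • ‖sgd φ lam η g₁ z n - p‖ ^ 2 := by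
    rw [havg]
    refine hconv.map_sum_le (fun n _ => ?_) hsum fun _ _ => Set.mem_univ _
    rw [avgWeight_succ]
    positivity
  refine (mul_le_mul_of_nonneg_left hjensen (by positivity)).trans_eq ?_
  rw [Finset.mul_sum]
  refine Finset.sum_congr rfl fun n _ => ?_
  rw [avgWeight_succ, smul_eq_mul]
  field_simp

/-- The exponent of the supermartingale controlling stochastic gradient descent: the tilted and
weighted squared distance of the current iterate from `p`, plus the part of the strong convexity
drift accumulated over the previous iterates that the tilts leave over. -/
def sgdEnergy (φ : ℝ → ℝ) (lam γ c : ℝ) (g₁ p : H) (T n : ℕ) (z : ℕ → X × Label) : ℝ :=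
  sgdTilt c T n * (sgdWeight lam γ n * ‖sgd φ lam (stepSize lam γ) g₁ z n - p‖ ^ 2)
    + 1 / (6 * c * (T + 1)) * ∑ i ∈ Finset.range n,
      lam ^ 2 / 2 * (γ + i) * ‖sgd φ lam (stepSize lam γ) g₁ z i - p‖ ^ 2

theorem sgdEnergy_zero (T : ℕ) (z : ℕ → X × Label) :
    sgdEnergy φ lam γ c g₁ p T 0 z
      = lam ^ 2 * (γ * (γ - 1)) * ‖g₁ - p‖ ^ 2 / (12 * c * (T + 1)) := by
  simp only [sgdEnergy, sgd, sgdTilt, sgdWeight, Finset.range_zero, Finset.sum_empty,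
    Nat.cast_zero, add_zero, mul_zero]
  field_simp
  ring

theorem mul_norm_avgSgd_sub_sq_le_sgdEnergy (hc : 0 ≤ c) (hγ : 1 ≤ γ) (T : ℕ)
    (z : ℕ → X × Label) :
    lam ^ 2 * (2 * γ + T) / (24 * c)
        * ‖avgSgd φ lam (stepSize lam γ) (avgWeight γ T) g₁ T z - p‖ ^ 2
      ≤ sgdEnergy φ lam γ c g₁ p T (T + 1) z := by
  set κ : ℝ := 1 / (6 * c * (T + 1)) with hκ
  set a := ‖avgSgd φ lam (stepSize lam γ) (avgWeight γ T) g₁ T z - p‖ ^ 2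
  have hcurrent : 0 ≤ sgdTilt c T (T + 1) * (sgdWeight lam γ (T + 1)
      * ‖sgd φ lam (stepSize lam γ) g₁ z (T + 1) - p‖ ^ 2) :=
    mul_nonneg (sgdTilt_nonneg hc _ _) (mul_nonneg (sgdWeight_nonneg hγ _) (sq_nonneg _))
  calc lam ^ 2 * (2 * γ + T) / (24 * c) * a
      = κ * (lam ^ 2 / 2 * ((2 * γ + T) * (T + 1) / 2 * a)) := by
        rw [hκ]
        field_simp
        ring
    _ ≤ κ * (lam ^ 2 / 2 * ∑ i ∈ Finset.range (T + 1),
          (γ + i) * ‖sgd φ lam (stepSize lam γ) g₁ z i - p‖ ^ 2) := by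
        gcongr
        exact norm_avgSgd_sub_sq_le (by linarith) _ _ _ _ _
    _ = κ * ∑ i ∈ Finset.range (T + 1),
          lam ^ 2 / 2 * (γ + i) * ‖sgd φ lam (stepSize lam γ) g₁ z i - p‖ ^ 2 := by
        simp only [Finset.mul_sum, mul_assoc]
    _ ≤ sgdEnergy φ lam γ c g₁ p T (T + 1) z := le_add_of_nonneg_left hcurrent

theorem sgdEnergy_succ_update (T n : ℕ) (z : ℕ → X × Label) (x : X × Label) :
    sgdEnergy φ lam γ c g₁ p T (n + 1) (Function.update z (n + 1) x)
      = sgdTilt c T (n + 1) * sgdWeight lam γ (n + 1)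
          * ‖(sgd φ lam (stepSize lam γ) g₁ z n - p) - stepSize lam γ (n + 1)
            • stochGrad φ lam (sgd φ lam (stepSize lam γ) g₁ z n) x‖ ^ 2
        + 1 / (6 * c * (T + 1)) * ∑ i ∈ Finset.range (n + 1),
          lam ^ 2 / 2 * (γ + i) * ‖sgd φ lam (stepSize lam γ) g₁ z i - p‖ ^ 2 := by
  have hpast : ∑ i ∈ Finset.range (n + 1), lam ^ 2 / 2 * (γ + i)
        * ‖sgd φ lam (stepSize lam γ) g₁ (Function.update z (n + 1) x) i - p‖ ^ 2
      = ∑ i ∈ Finset.range (n + 1),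
        lam ^ 2 / 2 * (γ + i) * ‖sgd φ lam (stepSize lam γ) g₁ z i - p‖ ^ 2 :=
    Finset.sum_congr rfl fun i hi => by rw [sgd_update_of_lt _ _ _ _ (Finset.mem_range.1 hi)]
  rw [sgdEnergy, hpast, sgd_succ_update, sub_right_comm, mul_assoc (sgdTilt c T (n + 1))]

theorem sgdTilt_mul_drift_add_noise_le (hlam : 0 < lam) (hγ : 3 ≤ γ) (hc : 0 < c) {T n : ℕ}
    (hn : n ≤ T) {a : ℝ} (ha : 0 ≤ a) :
    sgdTilt c T (n + 1) * sgdWeight lam γ (n + 1)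
          * ((1 - 2 * stepSize lam γ (n + 1) * lam) * a + stepSize lam γ (n + 1) ^ 2 * (9 * c))
        + 2 * (sgdTilt c T (n + 1) * sgdWeight lam γ (n + 1) * stepSize lam γ (n + 1)) ^ 2
          * (c * a)
      ≤ sgdTilt c T n * (sgdWeight lam γ n * a)
        - 1 / (6 * c * (T + 1)) * (lam ^ 2 / 2 * (γ + n) * a) + 3 / (T + 1) := by
  set θ := sgdTilt c T (n + 1)
  set w := sgdWeight lam γ (n + 1)
  set η := stepSize lam γ (n + 1)
  have hγ0 : 0 < γ := by linarith
  have hθ : 0 ≤ θ := sgdTilt_nonneg hc.le _ _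
  have hdrift : w * (1 - 2 * η * lam) = sgdWeight lam γ n - lam ^ 2 / 2 * (γ + n) :=
    sgdWeight_succ_mul_one_sub hlam hγ0 n
  have hgrad : θ * (9 * c) * (w * η ^ 2) ≤ θ * (9 * c) * 1 :=
    mul_le_mul_of_nonneg_left (sgdWeight_succ_mul_stepSize_sq_le_one hlam hγ0 n) (by positivity)
  have hnoise : 2 * θ ^ 2 * c * a * (w * η) ^ 2
      ≤ 2 * θ ^ 2 * c * a * (3 / 2 * sgdWeight lam γ n) :=
    mul_le_mul_of_nonneg_left (sq_sgdWeight_succ_mul_stepSize_le hlam hγ n) (by positivity)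
  have htilt : (θ + 3 * c * θ ^ 2) * (sgdWeight lam γ n * a)
      ≤ sgdTilt c T n * (sgdWeight lam γ n * a) :=
    mul_le_mul_of_nonneg_right (sgdTilt_succ_add_le hc T n)
      (mul_nonneg (sgdWeight_nonneg (by linarith) n) ha)
  have hleft : 1 / (6 * c * (T + 1)) * (lam ^ 2 / 2 * (γ + n) * a)
      ≤ θ * (lam ^ 2 / 2 * (γ + n) * a) :=
    mul_le_mul_of_nonneg_right (le_sgdTilt hc (Nat.succ_le_succ hn)) (by positivity)
  have hconst := mul_sgdTilt_le hc T (n + 1)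
  linear_combination hgrad + hnoise + htilt + hleft + hconst + θ * a * hdrift

variable [MeasurableSpace X]

theorem measurable_sgdEnergy (hk : StronglyMeasurable (fun x : X => feature H x))
    (hφ : Differentiable ℝ φ) (T n : ℕ) :
    Measurable fun z : ℕ → X × Label => sgdEnergy φ lam γ c g₁ p T n z := by
  have hdist : ∀ i, Measurable fun z : ℕ → X × Label =>
      ‖sgd φ lam (stepSize lam γ) g₁ z i - p‖ ^ 2 := fun i =>
    ((stronglyMeasurable_sgd hk hφ _ g₁ i).sub stronglyMeasurable_const).norm.measurable.pow_const 2
  exact (((hdist n).const_mul _).const_mul _).add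
    ((Finset.measurable_fun_sum _ fun i _ => (hdist i).const_mul _).const_mul _)

variable {ρ : Measure (X × Label)} [IsProbabilityMeasure ρ]

theorem lintegral_exp_sgdEnergy_update_le (hk : StronglyMeasurable (fun x : X => feature H x))
    (hφ : Differentiable ℝ φ) (hc : ConvexOn ℝ Set.univ φ) (hM0 : 0 < M) (hR0 : 0 < R)
    (hM : ∀ (ζ : ℝ) (y : Label), |dloss φ ζ y| ≤ M) (hF : ∀ x : X, ‖feature H x‖ ≤ R)
    (hlam : 0 < lam) (hγ : 3 ≤ γ) (hp : IsMinOn (tikhonov (risk ρ φ) lam) Set.univ p)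
    (hg₁ : ‖g₁‖ ≤ 2 * (M * R) / lam) {T n : ℕ} (hn : n ≤ T) (z : ℕ → X × Label) :
    ∫⁻ x, ENNReal.ofReal (Real.exp
        (sgdEnergy φ lam γ ((M * R) ^ 2) g₁ p T (n + 1) (Function.update z (n + 1) x))) ∂ρ
      ≤ ENNReal.ofReal (Real.exp (3 / (T + 1)))
        * ENNReal.ofReal (Real.exp (sgdEnergy φ lam γ ((M * R) ^ 2) g₁ p T n z)) := by
  set c := (M * R) ^ 2
  have hc0 : 0 < c := by positivity
  set g := sgd φ lam (stepSize lam γ) g₁ z n with hgdef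
  set past := 1 / (6 * c * (T + 1)) * ∑ i ∈ Finset.range (n + 1),
    lam ^ 2 / 2 * (γ + i) * ‖sgd φ lam (stepSize lam γ) g₁ z i - p‖ ^ 2 with hpast
  have hγ0 : 0 ≤ γ := by linarith
  have hγ1 : 1 ≤ γ := by linarith
  have hg : ‖g‖ ≤ 2 * (M * R) / lam :=
    norm_sgd_le hlam hM hF (fun n => stepSize_nonneg hlam.le hγ0 (n + 1))
      (mul_stepSize_succ_le_one hlam hγ1) hg₁ z n
  have hstep := lintegral_exp_norm_sub_smul_sq_le (ρ := ρ)
    (stronglyMeasurable_stochGrad hk hφ stronglyMeasurable_const measurable_id).aestronglyMeasurable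
    (stepSize_nonneg hlam.le hγ0 (n + 1))
    (mul_nonneg (sgdTilt_nonneg hc0.le T (n + 1)) (sgdWeight_nonneg (lam := lam) hγ1 (n + 1)))
    (mul_norm_sub_sq_le_integral_inner_sub_stochGrad hk hφ hc hM hF hp g)
    (norm_stochGrad_le hlam hM hF hg) (abs_inner_sub_stochGrad_sub_le hM hF p g)
  have hexponent := sgdTilt_mul_drift_add_noise_le hlam hγ hc0 hn (sq_nonneg ‖g - p‖)
  simp only [sgdEnergy_succ_update, ← hgdef, ← hpast]
  simp only [Real.exp_add _ past, ENNReal.ofReal_mul (Real.exp_pos _).le]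
  rw [lintegral_mul_const' _ _ ENNReal.ofReal_ne_top]
  refine (mul_le_mul_left hstep _).trans ?_
  rw [← ENNReal.ofReal_mul (Real.exp_pos _).le, ← ENNReal.ofReal_mul (Real.exp_pos _).le,
    ← Real.exp_add, ← Real.exp_add]
  refine ENNReal.ofReal_le_ofReal (Real.exp_le_exp.2 ?_)
  rw [sgdEnergy, hpast, Finset.sum_range_succ]
  linear_combination hexponent

theorem lintegral_exp_sgdEnergy_le (hk : StronglyMeasurable (fun x : X => feature H x))
    (hφ : Differentiable ℝ φ) (hc : ConvexOn ℝ Set.univ φ) (hM0 : 0 < M) (hR0 : 0 < R)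
    (hM : ∀ (ζ : ℝ) (y : Label), |dloss φ ζ y| ≤ M) (hF : ∀ x : X, ‖feature H x‖ ≤ R)
    (hlam : 0 < lam) (hγ : 3 ≤ γ) (hp : IsMinOn (tikhonov (risk ρ φ) lam) Set.univ p)
    (hg₁ : ‖g₁‖ ≤ 2 * (M * R) / lam) (T : ℕ) :
    ∫⁻ z, ENNReal.ofReal (Real.exp (sgdEnergy φ lam γ ((M * R) ^ 2) g₁ p T (T + 1) z))
        ∂Measure.infinitePi (fun _ : ℕ => ρ)
      ≤ ENNReal.ofReal (Real.exp (3
          + lam ^ 2 * (γ * (γ - 1)) * ‖g₁ - p‖ ^ 2 / (12 * (M * R) ^ 2 * (T + 1)))) := by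
  refine (lintegral_infinitePi_le_pow_mul (c := ENNReal.ofReal (Real.exp (3 / (T + 1))))
    (N := T + 1) (Φ := fun n z =>
      ENNReal.ofReal (Real.exp (sgdEnergy φ lam γ ((M * R) ^ 2) g₁ p T n z)))
    (fun n => (measurable_sgdEnergy hk hφ T n).exp.ennreal_ofReal)
    (fun n hn z => lintegral_exp_sgdEnergy_update_le hk hφ hc hM0 hR0 hM hF hlam hγ hp hg₁
      (Nat.lt_succ_iff.1 hn) z) le_rfl).trans_eq ?_
  simp only [sgdEnergy_zero, lintegral_const, measure_univ, mul_one]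
  rw [← ENNReal.ofReal_pow (Real.exp_pos _).le, ← ENNReal.ofReal_mul (by positivity),
    ← Real.exp_nat_mul, ← Real.exp_add]
  push_cast
  rw [mul_div_cancel₀ _ (by positivity : (T : ℝ) + 1 ≠ 0)]

theorem measureReal_le_norm_avgSgd_sub_le (hk : StronglyMeasurable (fun x : X => feature H x))
    (hφ : Differentiable ℝ φ) (hc : ConvexOn ℝ Set.univ φ) (hM0 : 0 < M) (hR0 : 0 < R)
    (hM : ∀ (ζ : ℝ) (y : Label), |dloss φ ζ y| ≤ M) (hF : ∀ x : X, ‖feature H x‖ ≤ R)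
    (hlam : 0 < lam) (hγ : 3 ≤ γ) (hp : IsMinOn (tikhonov (risk ρ φ) lam) Set.univ p)
    (hg₁ : ‖g₁‖ ≤ 2 * (M * R) / lam) (T : ℕ) {r : ℝ} (hr : 0 ≤ r) :
    (Measure.infinitePi fun _ : ℕ => ρ).real
        {z | r ≤ ‖avgSgd φ lam (stepSize lam γ) (avgWeight γ T) g₁ T z - p‖}
      ≤ Real.exp (3 + lam ^ 2 * (γ * (γ - 1)) * ‖g₁ - p‖ ^ 2 / (12 * (M * R) ^ 2 * (T + 1))
          - lam ^ 2 * (2 * γ + T) / (24 * (M * R) ^ 2) * r ^ 2) := by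
  refine (measureReal_mono fun z hz => ?_).trans
    (measure_real_le_exp_of_lintegral_exp_le (measurable_sgdEnergy hk hφ T (T + 1))
      (lintegral_exp_sgdEnergy_le hk hφ hc hM0 hR0 hM hF hlam hγ hp hg₁ T) _)
  refine le_trans ?_ (mul_norm_avgSgd_sub_sq_le_sgdEnergy (sq_nonneg _) (by linarith) T z)
  exact mul_le_mul_of_nonneg_left (pow_le_pow_left₀ hr hz 2) (by positivity)

end Energy

section Minimizers

variable {E : Type*} [NormedAddCommGroup E] [InnerProductSpace ℝ E] {L : E → ℝ} {lam : ℝ}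

theorem tikhonov_lt_of_isMinOn (hL : ConvexOn ℝ Set.univ L) (hlam : 0 < lam) {p g : E}
    (hp : IsMinOn (tikhonov L lam) Set.univ p) (hg : g ≠ p) :
    tikhonov L lam p < tikhonov L lam g := by
  have hdist : 0 < ‖g - p‖ := norm_sub_pos_iff.2 hg
  exact (lt_add_of_pos_right _ (by positivity)).trans_le
    (strongConvexOn_quadratic_growth (strongConvexOn_tikhonov hL lam) trivial trivial hp)

theorem exists_isMinOn_tikhonov_norm_sub_lt [CompleteSpace E] (hL : ConvexOn ℝ Set.univ L)
    (hlsc : LowerSemicontinuous L) {g₀ : E} (hg₀ : IsMinOn L Set.univ g₀) :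
    ∃ q, IsMinOn L Set.univ q ∧ ∀ ε > 0, ∃ lam₀ > 0, ∀ lam, 0 < lam → lam ≤ lam₀ →
      ∃ p, IsMinOn (tikhonov L lam) Set.univ p ∧ ‖p - q‖ < ε := by
  have hbdd : BddBelow (Set.range L) := ⟨L g₀, Set.forall_mem_range.2 fun g => hg₀ trivial⟩
  have hex : ∀ lam : ℝ, ∃ p, 0 < lam → IsMinOn (tikhonov L lam) Set.univ p := fun lam => by
    by_cases hlam : 0 < lam
    · exact (exists_isMinOn_tikhonov hL hlsc hbdd hlam).imp fun _ hp _ => hp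
    · exact ⟨0, fun h => absurd h hlam⟩
  choose p hp using hex
  obtain ⟨q, hlim, hq⟩ := exists_tendsto_isMinOn_tikhonov hL hlsc hg₀ hp
  refine ⟨q, hq, fun ε hε => ?_⟩
  obtain ⟨lam₀, hlam₀, hsub⟩ :=
    mem_nhdsGT_iff_exists_Ioc_subset.1 (hlim (Metric.ball_mem_nhds q hε))
  exact ⟨lam₀, hlam₀, fun lam hlam hle =>
    ⟨p lam, hp lam hlam, mem_ball_iff_norm.1 (hsub ⟨hlam, hle⟩)⟩⟩

end Minimizers

section BayesRule

variable {X H : Type*} [MeasurableSpace X] [NormedAddCommGroup H] [InnerProductSpace ℝ H]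
  [CompleteSpace H] [RKHS ℝ H X ℝ] {ρ : Measure (X × Label)} [IsProbabilityMeasure ρ]
  {φ : ℝ → ℝ} {K : NNReal} {R : ℝ} {g q : H}

theorem IsBayesRule.isMinOn_risk (hg : IsBayesRule ρ φ fun x => g x) (hφ0 : ∀ v, 0 ≤ φ v)
    (hk : StronglyMeasurable (fun x : X => feature H x)) (hφ : LipschitzWith K φ)
    (hF : ∀ x : X, ‖feature H x‖ ≤ R) : IsMinOn (risk (H := H) ρ φ) Set.univ g := by
  intro f _
  have hle := hg.2 _ (measurable_apply hk f)
  rw [extRisk_eq_ofReal_risk hφ0 hk hφ hF, extRisk_eq_ofReal_risk hφ0 hk hφ hF] at hle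
  exact (ENNReal.ofReal_le_ofReal_iff (risk_nonneg hφ0 f)).1 hle

theorem IsBayesRule.of_isMinOn_risk (hg : IsBayesRule ρ φ fun x => g x)
    (hq : IsMinOn (risk (H := H) ρ φ) Set.univ q) (hφ0 : ∀ v, 0 ≤ φ v)
    (hk : StronglyMeasurable (fun x : X => feature H x)) (hφ : LipschitzWith K φ)
    (hF : ∀ x : X, ‖feature H x‖ ≤ R) : IsBayesRule ρ φ fun x => q x := by
  refine ⟨measurable_apply hk q, fun f hf => le_trans ?_ (hg.2 f hf)⟩
  rw [extRisk_eq_ofReal_risk hφ0 hk hφ hF, extRisk_eq_ofReal_risk hφ0 hk hφ hF]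
  exact ENNReal.ofReal_le_ofReal (hq trivial)

theorem IsBayesRule.exists_margin_and_isMinOn_tikhonov
    (hg : IsBayesRule ρ φ fun x => g x) (hk : StronglyMeasurable (fun x : X => feature H x))
    (hφ0 : ∀ v, 0 ≤ φ v) (hφ : Differentiable ℝ φ) (hc : ConvexOn ℝ Set.univ φ) {M : ℝ}
    (hM : ∀ (ζ : ℝ) (y : Label), |dloss φ ζ y| ≤ M) (hF : ∀ x : X, ‖feature H x‖ ≤ R) {δ : ℝ}
    (hδ : δ ∈ Set.Ioo (0 : ℝ) (1 / 2)) (hnoise : ∀ᵐ x ∂ρ.fst, δ < |condProb ρ x - 1 / 2|)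
    (hprob : ∀ᵐ x ∂ρ.fst, condProb ρ x ∈ Set.Ioo (0 : ℝ) 1) (hlink : LinkWellDefined φ)
    (hmono : MonotoneOn (linkFun φ) (Set.Ioo (0 : ℝ) 1))
    (hsign : ∀ μ ∈ Set.Ioo (0 : ℝ) 1, Real.sign (μ - 1 / 2) = Real.sign (linkFun φ μ)) :
    ∃ q : H, (∀ᵐ x ∂ρ.fst, margin φ δ ≤ |q x| ∧ Real.sign (q x) = Real.sign (condMean ρ x)) ∧
      ∀ ε > 0, ∃ lam₀ > 0, ∀ lam, 0 < lam → lam ≤ lam₀ →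
        ∃ p : H, IsMinOn (tikhonov (risk ρ φ) lam) Set.univ p ∧ ‖p - q‖ < ε := by
  have hLip := lipschitzWith_of_abs_dloss_le hφ hM
  obtain ⟨q, hqmin, hlim⟩ := exists_isMinOn_tikhonov_norm_sub_lt
    (convexOn_risk (ρ := ρ) hk hLip hc hF) (continuous_risk hk hLip hF).lowerSemicontinuous
    (hg.isMinOn_risk hφ0 hk hLip hF)
  have hqlink : ∀ᵐ x ∂ρ.fst, q x = linkFun φ (condProb ρ x) :=
    (hg.of_isMinOn_risk hqmin hφ0 hk hLip hF).ae_eq_linkFun hφ0 hφ.continuous.measurable hprob hlink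
      (aemeasurable_comp_condProb_of_monotoneOn hprob hmono)
      ((extRisk_eq_ofReal_risk hφ0 hk hLip hF q).trans_ne ENNReal.ofReal_ne_top)
  exact ⟨q, ae_margin_le_abs_and_sign_eq hδ hnoise hprob hlink hmono hsign hqlink, hlim⟩

end BayesRule

section ExcessError

variable {X H : Type*} [MeasurableSpace X] [NormedAddCommGroup H] [InnerProductSpace ℝ H]
  [CompleteSpace H] [RKHS ℝ H X ℝ] {ρ : Measure (X × Label)} {R m : ℝ} {f : X → ℝ}
  {p q : H}

theorem classError_eq_of_norm_sub_lt (hR : 0 < R) (hF : ∀ x : X, ‖feature H x‖ ≤ R)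
    (hq : ∀ᵐ x ∂ρ.fst, m ≤ |q x| ∧ Real.sign (q x) = Real.sign (f x)) {g : H}
    (hg : ‖g - q‖ < m / R) : classError ρ (fun x => g x) = classError ρ f := by
  refine classError_congr (hq.mono fun x hx => hx.2 ▸ sign_eq_of_abs_sub_lt ?_)
  calc |g x - q x| ≤ R * ‖g - q‖ := abs_apply_sub_le hF g q x
    _ < m := (lt_div_iff₀' hR).1 hg
    _ ≤ |q x| := hx.1

variable [IsProbabilityMeasure ρ] {Ω : Type*} [MeasurableSpace Ω] {P : Measure Ω} {G : Ω → H}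

theorem integrable_classError_sub [IsFiniteMeasure P]
    (hk : StronglyMeasurable (fun x : X => feature H x)) (hG : StronglyMeasurable G) (f : X → ℝ) :
    Integrable (fun ω => classError ρ (fun x => G ω x) - classError ρ f) P := by
  have hmeas : Measurable fun ω => classError ρ (fun x => G ω x) := by
    refine measurable_classError ?_
    simp only [← inner_feature (H := H)]
    exact ((hk.comp_measurable measurable_snd).inner
      (hG.comp_measurable measurable_fst)).measurable
  refine (Integrable.of_bound hmeas.aestronglyMeasurable 1 (Filter.Eventually.of_forall fun ω => ?_)
    ).sub (integrable_const _)
  obtain ⟨hnonneg, hle⟩ := classError_mem_Icc (ρ := ρ) fun x => G ω x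
  rwa [Real.norm_of_nonneg hnonneg]

theorem integral_classError_sub_le [IsFiniteMeasure P]
    (hk : StronglyMeasurable (fun x : X => feature H x)) (hG : StronglyMeasurable G)
    (hR : 0 < R) (hF : ∀ x : X, ‖feature H x‖ ≤ R)
    (hq : ∀ᵐ x ∂ρ.fst, m ≤ |q x| ∧ Real.sign (q x) = Real.sign (f x))
    (hpq : ‖p - q‖ < m / (2 * R)) :
    ∫ ω, (classError ρ (fun x => G ω x) - classError ρ f) ∂P
      ≤ P.real {ω | m / (2 * R) ≤ ‖G ω - p‖} := by
  set A : Set Ω := {ω | m / (2 * R) ≤ ‖G ω - p‖}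
  have hA : MeasurableSet A :=
    measurableSet_le measurable_const (hG.sub stronglyMeasurable_const).norm.measurable
  rw [← integral_indicator_one hA]
  refine integral_mono (integrable_classError_sub hk hG f)
    ((integrable_const (1 : ℝ)).indicator hA) fun ω => ?_
  by_cases hω : ω ∈ A
  · rw [Set.indicator_of_mem hω, Pi.one_apply]
    linarith [(classError_mem_Icc (ρ := ρ) fun x => G ω x).2, (classError_mem_Icc (ρ := ρ) f).1]
  · rw [Set.indicator_of_notMem hω]
    refine (sub_eq_zero.2 (classError_eq_of_norm_sub_lt hR hF hq ?_)).le
    calc ‖G ω - q‖ ≤ ‖G ω - p‖ + ‖p - q‖ := norm_sub_le_norm_sub_add_norm_sub _ _ _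
      _ < m / (2 * R) + m / (2 * R) := add_lt_add (not_le.1 hω) hpq
      _ = m / R := by
        field_simp
        norm_num

end ExcessError

section Constants

variable {lam γ M R m d : ℝ}

theorem three_le_of_stepSize_one_le (hlam : 0 < lam) (hγ : 0 < γ)
    (h : stepSize lam γ 1 ≤ 1 / (2 * lam)) : 3 ≤ γ := by
  rw [stepSize, Nat.cast_one, div_le_div_iff₀ (by positivity) (by positivity)] at h
  nlinarith

theorem initial_norm_bound_le (hlam : 0 < lam) (hMR : 0 ≤ M * R)
    (h : stepSize lam γ 1 ≤ 1 / (2 * lam)) :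
    (2 * stepSize lam γ 1 + 1 / lam) * M * R ≤ 2 * (M * R) / lam := by
  calc (2 * stepSize lam γ 1 + 1 / lam) * M * R
      = (2 * stepSize lam γ 1 + 1 / lam) * (M * R) := mul_assoc _ _ _
    _ ≤ (2 * (1 / (2 * lam)) + 1 / lam) * (M * R) := by gcongr
    _ = 2 * (M * R) / lam := by
      field_simp
      norm_num

theorem exp_tail_exponent_le (hlam : 0 < lam) (hγ : 0 < γ) (hM : 0 < M) (hR : 0 < R) {T : ℕ}
    (h : max (36 * M ^ 2 * R ^ 2 / (lam ^ 2 * (2 * γ + T)))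
        (γ * (γ - 1) * d / ((2 * γ + T) * (T + 1))) ≤ m ^ 2 / (32 * R ^ 2)) :
    Real.exp (3 + lam ^ 2 * (γ * (γ - 1)) * d / (12 * (M * R) ^ 2 * (T + 1))
        - lam ^ 2 * (2 * γ + T) / (24 * (M * R) ^ 2) * (m / (2 * R)) ^ 2)
      ≤ 2 * Real.exp (-(m ^ 2 * lam ^ 2 * (2 * γ + T) / (2 ^ 10 * 9 * M ^ 2 * R ^ 4))) := by
  have : 0 < 2 * γ + T := by positivity
  obtain ⟨hlarge, hinit⟩ := max_le_iff.1 h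
  set u := m ^ 2 * lam ^ 2 * (2 * γ + T) / (M ^ 2 * R ^ 4) with hu
  have hthree : 3 ≤ u / 384 := by
    rw [div_le_div_iff₀ (by positivity) (by positivity)] at hlarge
    rw [hu, div_div, le_div_iff₀ (by positivity)]
    linarith
  have hinitial : lam ^ 2 * (γ * (γ - 1)) * d / (12 * (M * R) ^ 2 * (T + 1)) ≤ u / 384 :=
    calc lam ^ 2 * (γ * (γ - 1)) * d / (12 * (M * R) ^ 2 * (T + 1))
        = lam ^ 2 * (2 * γ + T) / (12 * (M * R) ^ 2)
          * (γ * (γ - 1) * d / ((2 * γ + T) * (T + 1))) := by field_simp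
      _ ≤ lam ^ 2 * (2 * γ + T) / (12 * (M * R) ^ 2) * (m ^ 2 / (32 * R ^ 2)) := by gcongr
      _ = u / 384 := by
        rw [hu]
        field_simp
        ring
  have hradius : lam ^ 2 * (2 * γ + T) / (24 * (M * R) ^ 2) * (m / (2 * R)) ^ 2 = u / 96 := by
    rw [hu]
    field_simp
    ring
  have htarget : m ^ 2 * lam ^ 2 * (2 * γ + T) / (2 ^ 10 * 9 * M ^ 2 * R ^ 4) = u / 9216 := by
    rw [hu]
    field_simp
    ring
  rw [hradius, htarget]
  refine (Real.exp_le_exp.2 (?_ : _ ≤ -(u / 9216))).trans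
    (le_mul_of_one_le_left (Real.exp_pos _).le one_le_two)
  linarith

end Constants

theorem measureReal_setOf_eq_infinitePi {ι S Ω : Type*} [MeasurableSpace S] [MeasurableSpace Ω]
    {P : Measure Ω} [IsProbabilityMeasure P] {ρ : Measure S} {Z : ι → Ω → S}
    (hZ : ∀ t, Measurable (Z t)) (hind : iIndepFun Z P) (hlaw : ∀ t, P.map (Z t) = ρ)
    {A : Set (ι → S)} (hA : MeasurableSet A) :
    P.real {ω | (fun t => Z t ω) ∈ A} = (Measure.infinitePi fun _ : ι => ρ).real A := by
  have hmap := hind.map_fun_eq_infinitePi_map hZ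
  simp only [hlaw] at hmap
  rw [← hmap, map_measureReal_apply (measurable_pi_lambda _ hZ) hA]
  rfl

end

theorem theorem2_general
    {X : Type*} [MeasurableSpace X]
    (ρ : Measure (X × Label)) [IsProbabilityMeasure ρ]
    {H : Type*} [NormedAddCommGroup H] [InnerProductSpace ℝ H] [CompleteSpace H] [RKHS ℝ H X ℝ]
    (hk : StronglyMeasurable (fun x : X => feature H x))
    (φ : ℝ → ℝ) (hφ_nonneg : ∀ v, 0 ≤ φ v)
    (hφ_diff : Differentiable ℝ φ) (hφ_conv : ConvexOn ℝ Set.univ φ)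
    (M : ℝ) (hM : 0 < M) (hφ_bound : ∀ (ζ : ℝ) (y : Label), |dloss φ ζ y| ≤ M)
    (R : ℝ) (hR : 0 < R) (hkR : ∀ x : X, kern H x x ≤ R ^ 2)
    (δ : ℝ) (hδ : δ ∈ Set.Ioo (0 : ℝ) (1 / 2))
    (hnoise : ∀ᵐ x ∂ρ.fst, δ < |condProb ρ x - 1 / 2|)
    (hprob : ∀ᵐ x ∂ρ.fst, condProb ρ x ∈ Set.Ioo (0 : ℝ) 1)
    (hlink : LinkWellDefined φ)
    (hlink_mono : MonotoneOn (linkFun φ) (Set.Ioo (0 : ℝ) 1))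
    (hlink_sign : ∀ μ ∈ Set.Ioo (0 : ℝ) 1, Real.sign (μ - 1 / 2) = Real.sign (linkFun φ μ))
    (hbayes : ∃ gstar : H, IsBayesRule ρ φ (fun x => gstar x)) :
    ∃ lam₀ : ℝ, 0 < lam₀ ∧ ∀ lam : ℝ, 0 < lam → lam ≤ lam₀ →
      ∃ glam : H, (∀ g : H, g ≠ glam → regRisk ρ φ lam glam < regRisk ρ φ lam g) ∧
        ∀ γ : ℝ, 0 < γ → stepSize lam γ 1 ≤ 1 / (2 * lam) →
        ∀ g₁ : H, ‖g₁‖ ≤ (2 * stepSize lam γ 1 + 1 / lam) * M * R →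
        ∀ T : ℕ,
          max (36 * M ^ 2 * R ^ 2 / (lam ^ 2 * (2 * γ + T)))
              (γ * (γ - 1) * ‖g₁ - glam‖ ^ 2 / ((2 * γ + T) * (T + 1)))
            ≤ margin φ δ ^ 2 / (32 * R ^ 2) →
        ∀ {Ω : Type*} [MeasurableSpace Ω] (P : Measure Ω) [IsProbabilityMeasure P]
          (Z : ℕ → Ω → X × Label),
          (∀ t, Measurable (Z t)) → iIndepFun Z P → (∀ t, P.map (Z t) = ρ) →
          Integrable (fun ω => classError ρ (fun x =>
              avgSgd φ lam (stepSize lam γ) (avgWeight γ T) g₁ T (fun t => Z t ω) x)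
            - classError ρ (condMean ρ)) P ∧
          ∫ ω, (classError ρ (fun x =>
              avgSgd φ lam (stepSize lam γ) (avgWeight γ T) g₁ T (fun t => Z t ω) x)
            - classError ρ (condMean ρ)) ∂P
            ≤ 2 * Real.exp (-(margin φ δ ^ 2 * lam ^ 2 * (2 * γ + T)
                / (2 ^ 10 * 9 * M ^ 2 * R ^ 4))) := by
  have hF := norm_feature_le hR.le hkR
  have hLip := lipschitzWith_of_abs_dloss_le hφ_diff hφ_bound
  have hrisk := convexOn_risk (ρ := ρ) hk hLip hφ_conv hF
  have hm := margin_pos hlink_sign hδ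
  obtain ⟨gstar, hgstar⟩ := hbayes
  obtain ⟨q, hq, hlim⟩ := hgstar.exists_margin_and_isMinOn_tikhonov hk hφ_nonneg hφ_diff hφ_conv
    hφ_bound hF hδ hnoise hprob hlink hlink_mono hlink_sign
  obtain ⟨lam₀, hlam₀, hnear⟩ := hlim (margin φ δ / (2 * R)) (by positivity)
  refine ⟨lam₀, hlam₀, fun lam hlam hle => ?_⟩
  obtain ⟨p, hp, hpq⟩ := hnear lam hlam hle
  refine ⟨p, fun g hg => by
    simpa only [regRisk_eq_tikhonov] using tikhonov_lt_of_isMinOn hrisk hlam hp hg,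
    fun γ hγ hstep g₁ hg₁ T hT Ω _ P _ Z hZ hind hlaw => ?_⟩
  have havg : StronglyMeasurable fun z : ℕ → X × Label =>
      avgSgd φ lam (stepSize lam γ) (avgWeight γ T) g₁ T z :=
    stronglyMeasurable_avgSgd hk hφ_diff _ _ _ _
  have havgZ := havg.comp_measurable (measurable_pi_lambda (fun ω t => Z t ω) hZ)
  refine ⟨integrable_classError_sub hk havgZ _,
    (integral_classError_sub_le hk havgZ hR hF hq hpq).trans
      ((measureReal_setOf_eq_infinitePi hZ hind hlaw (measurableSet_le measurable_const
        (havg.sub stronglyMeasurable_const).norm.measurable)).trans_le ?_)⟩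
  exact (measureReal_le_norm_avgSgd_sub_le hk hφ_diff hφ_conv hM hR hφ_bound hF hlam
    (three_le_of_stepSize_one_le hlam hγ hstep) hp
    (hg₁.trans (initial_norm_bound_le hlam (by positivity) hstep)) T (by positivity)).trans
    (exp_tail_exponent_le hlam hγ hM hR hT)

theorem theorem2
    {X : Type*} [TopologicalSpace X] [MeasurableSpace X]
    (ρ : Measure (X × Label)) [IsProbabilityMeasure ρ]
    {H : Type*} [NormedAddCommGroup H] [InnerProductSpace ℝ H] [CompleteSpace H] [RKHS ℝ H X ℝ]
    -- `x ↦ k(x, ·)` is a (Bochner) measurable map into `H`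
    (hk : StronglyMeasurable (fun x : X => feature H x))
    (φ : ℝ → ℝ) (hφ_nonneg : ∀ v, 0 ≤ φ v)
    -- (A1)
    (hφ_diff : Differentiable ℝ φ) (hφ_conv : ConvexOn ℝ Set.univ φ)
    (M : ℝ) (hM : 0 < M) (hφ_bound : ∀ (ζ : ℝ) (y : Label), |dloss φ ζ y| ≤ M)
    -- (A2)
    (hsupp : ρ.fst.support = Set.univ)
    (R : ℝ) (hR : 0 < R) (hkR : ∀ x : X, kern H x x ≤ R ^ 2)
    -- (A3)
    (δ : ℝ) (hδ : δ ∈ Set.Ioo (0 : ℝ) (1 / 2))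
    (hnoise : ∀ᵐ x ∂ρ.fst, δ < |condProb ρ x - 1 / 2|)
    -- (A4)
    (hprob : ∀ᵐ x ∂ρ.fst, condProb ρ x ∈ Set.Ioo (0 : ℝ) 1)
    (hlink : LinkWellDefined φ)
    (hlink_diff : DifferentiableOn ℝ (linkFun φ) (Set.Ioo (0 : ℝ) 1))
    (hlink_mono : MonotoneOn (linkFun φ) (Set.Ioo (0 : ℝ) 1))
    (hlink_inj : Set.InjOn (linkFun φ) (Set.Ioo (0 : ℝ) 1))
    (hlink_sign : ∀ μ ∈ Set.Ioo (0 : ℝ) 1, Real.sign (μ - 1 / 2) = Real.sign (linkFun φ μ))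
    -- (A5)
    (hbregman : ∀ η₁ ∈ Set.Ioo (0 : ℝ) 1, ∀ η₂ ∈ Set.Ioo (0 : ℝ) 1,
      (bregman φ η₁ η₂ = 0 ↔ η₁ = η₂))
    (hbayes : ∃ gstar : H, IsBayesRule ρ φ (fun x => gstar x) ∧
      ∀ f : X → ℝ, IsBayesRule ρ φ f → f =ᵐ[ρ.fst] fun x => gstar x) :
    ∃ lam₀ : ℝ, 0 < lam₀ ∧ ∀ lam : ℝ, 0 < lam → lam ≤ lam₀ →
      -- `glam` is the minimizer of the regularized expected risk over `H`
      ∃ glam : H, (∀ g : H, g ≠ glam → regRisk ρ φ lam glam < regRisk ρ φ lam g) ∧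
        ∀ γ : ℝ, 0 < γ → stepSize lam γ 1 ≤ 1 / (2 * lam) →
        ∀ g₁ : H, ‖g₁‖ ≤ (2 * stepSize lam γ 1 + 1 / lam) * M * R →
        ∀ T : ℕ,
          max (36 * M ^ 2 * R ^ 2 / (lam ^ 2 * (2 * γ + T)))
              (γ * (γ - 1) * ‖g₁ - glam‖ ^ 2 / ((2 * γ + T) * (T + 1)))
            ≤ margin φ δ ^ 2 / (32 * R ^ 2) →
        -- independent samples `Z 1, Z 2, …` drawn from `ρ`
        ∀ {Ω : Type*} [MeasurableSpace Ω] (P : Measure Ω) [IsProbabilityMeasure P]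
          (Z : ℕ → Ω → X × Label),
          (∀ t, Measurable (Z t)) → iIndepFun Z P → (∀ t, P.map (Z t) = ρ) →
          Integrable (fun ω => classError ρ (fun x =>
              avgSgd φ lam (stepSize lam γ) (avgWeight γ T) g₁ T (fun t => Z t ω) x)
            - classError ρ (condMean ρ)) P ∧
          ∫ ω, (classError ρ (fun x =>
              avgSgd φ lam (stepSize lam γ) (avgWeight γ T) g₁ T (fun t => Z t ω) x)
            - classError ρ (condMean ρ)) ∂P
            ≤ 2 * Real.exp (-(margin φ δ ^ 2 * lam ^ 2 * (2 * γ + T)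
                / (2 ^ 10 * 9 * M ^ 2 * R ^ 4))) :=
  theorem2_general ρ hk φ hφ_nonneg hφ_diff hφ_conv M hM hφ_bound R hR hkR δ hδ hnoise hprob hlink
    hlink_mono hlink_sign (hbayes.imp fun _ h => h.1)
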